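/- **Setting.** Let $n\ge 1$ and let $\mathcal T=\mathbb R^2/(n\mathbb Z)^2$ be the oriented torus with its $n$ vertical circles $\{i\}\times S^1$, its $n$ horizontal circles $S^1\times\{j\}$ ($i,j\in\mathbb Z/n$), and the induced cell decomposition into $n^2$ unit squares. A *generator* is a one-to-one correspondence between the vertical and the horizontal circles, viewed as an $n$-tuple of intersection points with exactly one point on each vertical and on each horizontal circle; $\mathbf S$ is the set of generators. For $\mathbf x,\mathbf y\in\mathbf S$, an embedded rectangle $r\subset\mathcal T$ with edges on the horizontal and vertical circles *connects $\mathbf x$ to $\mathbf y$* if $\mathbf x$ and $\mathbf y$ agree along all but two horizontal circles, the four corners of $r$ lie in $\mathbf x\cup\mathbf y$, and each horizontal edge of $r$, with its boundary orientation, goes from a point of $\mathbf x$ to a point of $\mathbf y$ (so the lower left and upper right corners belong to $\mathbf x$). It is *empty* if its interior contains no point of $\mathbf x$. Let $\mathrm{Rect}^\circ(\mathbf x,\mathbf y)$ be the set of empty rectangles connecting $\mathbf x$ to $\mathbf y$, and let $\mathrm{Rect}^\circ$ be the disjoint union of these sets over all pairs $(\mathbf x,\mathbf y)$. A *domain* from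 $\mathbf x$ to $\mathbf y$ is a cellular two-chain $p$ of $\mathcal T$ such that the part of $\partial p$ on the horizontal circles has boundary $\mathbf y-\mathbf x$. Every rectangle connecting $\mathbf x$ to $\mathbf y$ is such a domain. A domain from $\mathbf x$ to $\mathbf y$ and a domain from $\mathbf y$ to $\mathbf z$ have a composite, their sum, denoted $*$, which is a domain from $\mathbf x$ to $\mathbf z$. An equality $r_1*r_2=r_1'*r_2'$ means equality as domains with the same initial and the same final generator. A *vertical* (*horizontal*) *annulus* is the region of $\mathcal T$ swept from one vertical (horizontal) circle to a different one, taken with multiplicity one. A *(true) sign assignment* is a function $\mathcal S\colon\mathrm{Rect}^\circ\to\{\pm1\}$ such that * (Sq) for any four distinct $r_1,r_2,r_1',r_2'\in\mathrm{Rect}^\circ$ with $r_1*r_2=r_1'*r_2'$, we have $\mathcal S(r_1)\,\mathcal S(r_2)=-\mathcal S(r_1')\,\mathcal S(r_2')$; * (V) if $r_1,r_2\in\mathrm{Rect}^\circ$ and $r_1*r_2$ is a vertical annulus, then $\mathcal S(r_1)\,\mathcal S(r_2)=-1$; * (H) if $r_1,r_2\in\mathrm{Rect}^\circ$ and $r_1*r_2$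 is a horizontal annulus, then $\mathcal S(r_1)\,\mathcal S(r_2)=+1$. **Theorem.** For every $n\ge 1$ there is a sign assignment. Moreover, it is essentially unique: if $\mathcal S_1$ and $\mathcal S_2$ are two sign assignments, then there is a function $f\colon\mathbf S\to\{\pm1\}$ such that for all $\mathbf x,\mathbf y\in\mathbf S$ and all $r\in\mathrm{Rect}^\circ(\mathbf x,\mathbf y)$, $$\mathcal S_1(r)=f(\mathbf x)\,f(\mathbf y)\,\mathcal S_2(r).$$ -/

import Mathlib

/-!
Generators, rectangles and domains of an `n × n` toroidal grid, and sign assignments.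

The torus is `ℝ²/(nℤ)²`.  Its vertical circles `{i} × S¹` and its horizontal circles `S¹ × {j}` are
indexed by `ZMod n`, and the pair `(i, j)` also names the cell `[i, i+1] × [j, j+1]`.
None of the notions below involves the `X` and `O` markings of a grid diagram.
-/

namespace ToroidalGrid

/-- A generator: a one-to-one correspondence from vertical to horizontal circles.  The generator
`x` is thought of as the `n`-tuple of intersection points `(i, x i)`. -/
abbrev Gen (n : ℕ) : Type := Equiv.Perm (ZMod n)

/-- `c` lies on the cyclic half-open interval `[a, b)`, travelled in the positive direction. It is
empty if `a = b`. For indices of cells this says that `[c, c+1]` is part of the arc `[a, b]`. -/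
abbrev InArc {n : ℕ} (a b c : ZMod n) : Prop := (c - a).val < (b - a).val

/-- `c` lies on the cyclic open interval `(a, b)`, travelled in the positive direction. -/
abbrev InOpenArc {n : ℕ} (a b c : ZMod n) : Prop := c ≠ a ∧ InArc a b c

/-- A cellular two-chain of the torus: `p i j` is the multiplicity of `[i, i+1] × [j, j+1]`. -/
abbrev TwoChain (n : ℕ) : Type := ZMod n → ZMod n → ℤ

/-- The part of the boundary of a two-chain that lies on the horizontal circles.  The edge
`(i, j)` goes from the vertex `(i, j)` to the vertex `(i+1, j)`. -/
def TwoChain.horizontalBoundary {n : ℕ} (p : TwoChain n) (i j : ZMod n) : ℤ :=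
  p i j - p i (j - 1)

/-- The boundary of a one-chain that is supported on the horizontal circles: its coefficient at
the vertex `(i, j)`. -/
def vertexBoundary {n : ℕ} (h : ZMod n → ZMod n → ℤ) (i j : ZMod n) : ℤ :=
  h (i - 1) j - h i j

/-- A generator as a zero-chain: the sum of its points. -/
def Gen.zeroChain {n : ℕ} (x : Gen n) (i j : ZMod n) : ℤ :=
  if x i = j then 1 else 0

/-- The domains from `x` to `y`: the two-chains `p` such that the part of `∂p` on the horizontal
circles has boundary `y - x`. -/
def Domain {n : ℕ} (x y : Gen n) : Type :=
  {p : TwoChain n // ∀ i j : ZMod n,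
    vertexBoundary p.horizontalBoundary i j = y.zeroChain i j - x.zeroChain i j}

/-- The composition law `*` on domains: addition of two-chains. -/
def Domain.comp {n : ℕ} {x y z : Gen n} (p : Domain x y) (q : Domain y z) : Domain x z :=
  ⟨fun i j => p.1 i j + q.1 i j, fun i j => by
    have hp := p.2 i j
    have hq := q.2 i j
    simp only [vertexBoundary, TwoChain.horizontalBoundary] at hp hq ⊢
    linarith⟩

/-- An embedded rectangle in the torus with edges on the horizontal and vertical circles,
namely `[left, right] × [bottom, top]`, where the intervals are positively oriented arcs. -/
@[ext] structure GridRect (n : ℕ) where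
  left : ZMod n
  right : ZMod n
  bottom : ZMod n
  top : ZMod n
  left_ne_right : left ≠ right
  bottom_ne_top : bottom ≠ top

/-- The two-chain of a rectangle: the sum of its cells. -/
def GridRect.chain {n : ℕ} (r : GridRect n) : TwoChain n := fun i j =>
  if InArc r.left r.right i ∧ InArc r.bottom r.top j then 1 else 0

/-- `r` connects `x` to `y`: the generators agree away from the edges of `r`, and the horizontal
edges of `r`, with the boundary orientation, go from points of `x` to points of `y` (the bottom edge
is traversed from left to right, the top edge from right to left). -/
structure GridRect.Connects {n : ℕ} (r : GridRect n) (x y : Gen n) : Prop where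
  agree : ∀ i : ZMod n, i ≠ r.left → i ≠ r.right → x i = y i
  lower_left : x r.left = r.bottom
  lower_right : y r.right = r.bottom
  upper_right : x r.right = r.top
  upper_left : y r.left = r.top

/-- No point of `x` lies in the interior of `r`. -/
def GridRect.EmptyOf {n : ℕ} (r : GridRect n) (x : Gen n) : Prop :=
  ∀ i : ZMod n, ¬ (InOpenArc r.left r.right i ∧ InOpenArc r.bottom r.top (x i))

/-- The empty rectangles connecting `x` to `y`. -/
def EmptyRect {n : ℕ} (x y : Gen n) : Type :=
  {r : GridRect n // r.Connects x y ∧ r.EmptyOf x}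

/-- The set of all empty rectangles, the disjoint union over all pairs of generators. -/
abbrev EmptyRects (n : ℕ) : Type := Σ x : Gen n, Σ y : Gen n, EmptyRect x y

/-- An empty rectangle, as an element of the set of all empty rectangles. -/
abbrev EmptyRect.mk {n : ℕ} {x y : Gen n} (r : EmptyRect x y) : EmptyRects n := ⟨x, y, r⟩

theorem arc_step {n : ℕ} [NeZero n] {a b : ZMod n} (hab : a ≠ b) (i : ZMod n) :
    ((if InArc a b i then 1 else 0 : ℤ) - if InArc a b (i - 1) then 1 else 0) =
      (if i = a then 1 else 0) - if i = b then 1 else 0 := by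
  have hm : 0 < (b - a).val := by
    rw [Nat.pos_iff_ne_zero, Ne, ZMod.val_eq_zero, sub_eq_zero]
    exact fun h => hab h.symm
  have hmn : (b - a).val < n := ZMod.val_lt _
  have hib : i = b ↔ (i - a).val = (b - a).val := by
    rw [(ZMod.val_injective n).eq_iff, sub_left_inj]
  have hn : 1 < n := by omega
  have : Fact (1 < n) := ⟨hn⟩
  by_cases hia : i = a
  · subst hia
    have h1 : (i - 1 - i).val = n - 1 := by
      have : i - 1 - i = -1 := by ring
      rw [this, ZMod.neg_val, if_neg one_ne_zero, ZMod.val_one]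
    simp only [InArc, h1, sub_self, ZMod.val_zero, hm, hab, if_true, if_false]
    rw [if_neg (by omega)]
  · have hpos : 1 ≤ (i - a).val := by
      rw [Nat.one_le_iff_ne_zero, Ne, ZMod.val_eq_zero, sub_eq_zero]
      exact hia
    have h1 : (i - 1 - a).val = (i - a).val - 1 := by
      have : i - 1 - a = (i - a) - 1 := by ring
      rw [this, ZMod.val_sub (by rw [ZMod.val_one]; exact hpos), ZMod.val_one]
    simp only [InArc, h1, hib, hia, if_false]
    split_ifs <;> omega

theorem GridRect.Connects.chain_boundary {n : ℕ} [NeZero n] {r : GridRect n} {x y : Gen n}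
    (h : r.Connects x y) (i j : ZMod n) :
    vertexBoundary r.chain.horizontalBoundary i j = y.zeroChain i j - x.zeroChain i j := by
  have hc : ∀ i j, r.chain i j = (if InArc r.left r.right i then 1 else 0) *
      (if InArc r.bottom r.top j then 1 else 0) := by
    intro i j
    unfold GridRect.chain
    split_ifs <;> simp_all
  have hi := arc_step r.left_ne_right i
  have hj := arc_step r.bottom_ne_top j
  have key : vertexBoundary r.chain.horizontalBoundary i j =
      -((if i = r.left then 1 else 0) - if i = r.right then 1 else 0) *
        ((if j = r.bottom then 1 else 0) - if j = r.top then 1 else 0) := by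
    rw [← hi, ← hj]
    simp only [vertexBoundary, TwoChain.horizontalBoundary, hc]
    ring
  have hlr := r.left_ne_right
  rw [key]
  simp only [Gen.zeroChain]
  by_cases h1 : i = r.left
  · subst h1
    simp only [h.lower_left, h.upper_left, hlr, if_true, if_false, eq_comm (a := j)]
    ring
  · by_cases h2 : i = r.right
    · subst h2
      simp only [h.lower_right, h.upper_right, h1, if_true, if_false, eq_comm (a := j)]
      ring
    · simp [h1, h2, h.agree i h1 h2]

/-- An empty rectangle from `x` to `y`, as a domain from `x` to `y`. -/
def EmptyRect.domain {n : ℕ} [NeZero n] {x y : Gen n} (r : EmptyRect x y) : Domain x y :=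
  ⟨r.1.chain, r.2.1.chain_boundary⟩

/-- The two-chain is a vertical annulus `[a, b] × S¹`, taken once. -/
def TwoChain.IsVerticalAnnulus {n : ℕ} (p : TwoChain n) : Prop :=
  ∃ a b : ZMod n, a ≠ b ∧ ∀ i j : ZMod n, p i j = if InArc a b i then 1 else 0

/-- The two-chain is a horizontal annulus `S¹ × [a, b]`, taken once. -/
def TwoChain.IsHorizontalAnnulus {n : ℕ} (p : TwoChain n) : Prop :=
  ∃ a b : ZMod n, a ≠ b ∧ ∀ i j : ZMod n, p i j = if InArc a b j then 1 else 0

/-- A (true) sign assignment. -/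
structure IsSignAssignment {n : ℕ} [NeZero n] (S : EmptyRects n → ℤˣ) : Prop where
  square : ∀ (x y y' z : Gen n) (r₁ : EmptyRect x y) (r₂ : EmptyRect y z)
    (r₁' : EmptyRect x y') (r₂' : EmptyRect y' z),
    [r₁.mk, r₂.mk, r₁'.mk, r₂'.mk].Nodup →
    r₁.domain.comp r₂.domain = r₁'.domain.comp r₂'.domain →
    S r₁.mk * S r₂.mk = -(S r₁'.mk * S r₂'.mk)
  vertical : ∀ (x y z : Gen n) (r₁ : EmptyRect x y) (r₂ : EmptyRect y z),
    TwoChain.IsVerticalAnnulus (r₁.domain.comp r₂.domain).1 → S r₁.mk * S r₂.mk = -1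
  horizontal : ∀ (x y z : Gen n) (r₁ : EmptyRect x y) (r₂ : EmptyRect y z),
    TwoChain.IsHorizontalAnnulus (r₁.domain.comp r₂.domain).1 → S r₁.mk * S r₂.mk = 1

end ToroidalGrid

/-!
An empty rectangle that starts at a generator `x` is determined by its left and right edges `a`,
`b`, and it leads to `x * swap a b`. So an empty rectangle is an oriented edge of the Cayley
graph of the symmetric group with respect to all transpositions, together with an order of the two
columns of the transposition.

*Existence.* The signs come from the spin extension of the symmetric group. In the Clifford algebra
of a negative definite form the unit vectors `τ a b` along `e_a - e_b` lift the transpositions; they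
satisfy `τ b a = -τ a b`, `τ a b ^ 2 = -1`, they anticommute if the transpositions are disjoint, and
`τ a b * τ b c = τ b c * τ c a`. The products of such vectors form an extension of the symmetric
group by `±1` (`IsLift.eq_one_or`). Choose a lift `ρ x` of every generator `x`, and let the sign of
a rectangle from `x` to `y` with left edge `a` and right edge `b` be the one in
`ρ x * τ a b = ± ρ y`. In a vertical annulus both rectangles have the same left edge, and the
product of their signs is `τ a b ^ 2 = -1`; in a horizontal annulus left and right are interchanged,
and the product is `τ a b * τ b a = 1`. For two decompositions of the same domain the products of
the lifts are opposite (`IsSpinSystem.square`): this is the anticommutation of disjoint transpositions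
or, for an L-shaped domain, a finite check with three columns and three rows.

*Uniqueness.* The ratio `φ` of two sign assignments is a cocycle: its products agree along the two
decompositions of a domain and are `1` on annuli. Restricted to rectangles of width one it satisfies
the relations of the symmetric group as a Coxeter group; the braid relation follows from the two
L-shaped domains that share a rectangle of width two (`IsCocycle.hexagon`). Sorting a permutation by
adjacent transpositions gives a potential, well defined by these relations
(`IsCocycle.sortingPotential_eq`), and after division by its coboundary `φ` is trivial on all
rectangles of width one that do not cross the column between the circles `n - 1` and `0`. An
L-shaped domain expresses the value on a wide rectangle by the one on a narrower rectangle
(`IsCocycle.eq_one_of_thin`), so `φ` is trivial on all rectangles that do not meet that last column.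
For rectangles of width one in the last column induct on the height (`IsCocycle.last_thin`): in
height one the horizontal annulus relates them to a rectangle that avoids the last column, and the
braid relation reduces greater height to smaller height. Hence `φ` is trivial everywhere.
-/

namespace ToroidalGrid

/-! ### Cyclic arcs -/

/-- Arcs in terms of the representatives `0, …, n - 1`: either `[a, b)` does not pass through
`n - 1, 0` or it does. Statements about the cyclic order become linear arithmetic in this way. -/
theorem inArc_iff {n : ℕ} [NeZero n] {a b c : ZMod n} :
    InArc a b c ↔ (a.val ≤ c.val ∧ c.val < b.val) ∨
      (b.val < a.val ∧ (a.val ≤ c.val ∨ c.val < b.val)) := by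
  have key (p q : ZMod n) : (p - q).val = if q.val ≤ p.val then p.val - q.val
      else p.val + n - q.val := by
    split_ifs with h
    · exact ZMod.val_sub h
    · have h' : 0 < q.val := by omega
      have : NeZero q := ⟨fun h0 => by simp [h0] at h'⟩
      have hq := ZMod.val_lt q
      have hneg : (-q).val = n - q.val := ZMod.val_neg_of_ne_zero q
      rw [sub_eq_add_neg, ZMod.val_add_of_lt, hneg]
      · omega
      · omega
  have ha := ZMod.val_lt a
  have hb := ZMod.val_lt b
  have hc := ZMod.val_lt c
  rw [InArc, key, key]
  split_ifs <;> omega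

theorem inArc_left {n : ℕ} [NeZero n] {a b : ZMod n} (h : a ≠ b) : InArc a b a := by
  have := (ZMod.val_injective n).ne h
  rw [inArc_iff]; omega

theorem not_inArc_right {n : ℕ} [NeZero n] {a b : ZMod n} : ¬ InArc a b b := by
  rw [inArc_iff]; omega

/-- Three distinct points of a circle are in exactly one of the two cyclic orders. -/
theorem not_inArc_comm {n : ℕ} [NeZero n] {a b c : ZMod n} (hab : a ≠ b) (hac : a ≠ c)
    (hbc : b ≠ c) : ¬ InArc a b c ↔ InArc a c b := by
  have := (ZMod.val_injective n).ne hab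
  have := (ZMod.val_injective n).ne hac
  have := (ZMod.val_injective n).ne hbc
  rw [inArc_iff, inArc_iff]; omega

theorem inArc_rotate {n : ℕ} [NeZero n] {a b c : ZMod n} (hab : a ≠ b) (hac : a ≠ c)
    (hbc : b ≠ c) : InArc a b c ↔ InArc b c a := by
  have := (ZMod.val_injective n).ne hab
  have := (ZMod.val_injective n).ne hac
  have := (ZMod.val_injective n).ne hbc
  rw [inArc_iff, inArc_iff]; omega

/-- The indicator function of the arc `[a, b)`. -/
def arcInd {n : ℕ} (a b t : ZMod n) : ℤ := if InArc a b t then 1 else 0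

theorem arcInd_add {n : ℕ} [NeZero n] {a b c : ZMod n} (h : InArc a c b) (t : ZMod n) :
    arcInd a c t = arcInd a b t + arcInd b c t := by
  unfold arcInd
  simp only [inArc_iff] at *
  split_ifs <;> omega

theorem arcInd_compl {n : ℕ} [NeZero n] {a b : ZMod n} (h : a ≠ b) (t : ZMod n) :
    arcInd b a t = 1 - arcInd a b t := by
  have := (ZMod.val_injective n).ne h
  unfold arcInd
  simp only [inArc_iff] at *
  split_ifs <;> omega

theorem arcInd_left {n : ℕ} [NeZero n] {a b : ZMod n} (h : a ≠ b) : arcInd a b a = 1 :=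
  if_pos (inArc_left h)

theorem arcInd_right {n : ℕ} [NeZero n] (a b : ZMod n) : arcInd a b b = 0 :=
  if_neg not_inArc_right

theorem arcInd_step {n : ℕ} [NeZero n] {a b : ZMod n} (hab : a ≠ b) (i : ZMod n) :
    arcInd a b i - arcInd a b (i - 1) = (if i = a then 1 else 0) - if i = b then 1 else 0 :=
  arc_step hab i

theorem arcInd_injective {n : ℕ} [NeZero n] {a b a' b' : ZMod n} (hab : a ≠ b) (hab' : a' ≠ b')
    (h : ∀ i, arcInd a b i = arcInd a' b' i) : a = a' ∧ b = b' := by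
  have key (i : ZMod n) := (arcInd_step hab i).symm.trans
    ((congrArg₂ (· - ·) (h i) (h (i - 1))).trans (arcInd_step hab' i))
  have ha := key a
  have hb := key b
  constructor
  · by_contra hne
    rw [if_pos rfl, if_neg hab, if_neg hne] at ha
    split_ifs at ha <;> omega
  · by_contra hne
    rw [if_pos rfl, if_neg hab.symm, if_neg hne] at hb
    split_ifs at hb <;> omega

/-! ### Rectangles based at a generator -/

theorem Gen.mul_swap_mul_swap {n : ℕ} (x : Gen n) (a b : ZMod n) :
    x * Equiv.swap a b * Equiv.swap a b = x := by
  rw [mul_assoc, Equiv.swap_mul_self, mul_one]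

/-- The columns `a ≠ b` are the left and the right edge of an empty rectangle that starts at `x`;
its lower edge is then in row `x a` and its upper edge in row `x b`. -/
structure Gen.HasRect {n : ℕ} (x : Gen n) (a b : ZMod n) : Prop where
  ne : a ≠ b
  empty : ∀ i, ¬ (InOpenArc a b i ∧ InOpenArc (x a) (x b) (x i))

/-- The empty rectangle from `x` to `x * swap a b` with left edge `a` and right edge `b`. -/
def Gen.HasRect.rect {n : ℕ} {x : Gen n} {a b : ZMod n} (h : x.HasRect a b) :
    EmptyRect x (x * Equiv.swap a b) :=
  ⟨⟨a, b, x a, x b, h.ne, x.injective.ne h.ne⟩,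
    ⟨fun i h₁ h₂ => by simp [Equiv.swap_apply_of_ne_of_ne h₁ h₂], rfl, by simp, rfl, by simp⟩,
    h.empty⟩

theorem EmptyRect.target_eq {n : ℕ} {x y : Gen n} (r : EmptyRect x y) :
    y = x * Equiv.swap r.1.left r.1.right := by
  ext i : 1
  rw [Equiv.Perm.mul_apply]
  by_cases h₁ : i = r.1.left
  · rw [h₁, Equiv.swap_apply_left, r.2.1.upper_left, r.2.1.upper_right]
  · by_cases h₂ : i = r.1.right
    · rw [h₂, Equiv.swap_apply_right, r.2.1.lower_right, r.2.1.lower_left]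
    · rw [Equiv.swap_apply_of_ne_of_ne h₁ h₂, r.2.1.agree i h₁ h₂]

theorem EmptyRect.hasRect {n : ℕ} {x y : Gen n} (r : EmptyRect x y) :
    x.HasRect r.1.left r.1.right :=
  ⟨r.1.left_ne_right, fun i => by
    rw [r.2.1.lower_left, r.2.1.upper_right]; exact r.2.2 i⟩

/-- Every empty rectangle is determined by its initial generator and its vertical edges. -/
theorem EmptyRect.exists_eq_rect {n : ℕ} {x y : Gen n} (r : EmptyRect x y) :
    ∃ (a b : ZMod n) (h : x.HasRect a b), r.mk = h.rect.mk ∧ y = x * Equiv.swap a b := by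
  refine ⟨_, _, r.hasRect, ?_, r.target_eq⟩
  have key : ∀ (z : Gen n) (hz : z = x * Equiv.swap r.1.left r.1.right) (q : EmptyRect x z),
      q.1 = r.1 → q.mk = r.hasRect.rect.mk := by
    rintro z rfl q hq
    have : q = r.hasRect.rect := Subtype.ext (hq.trans
      (GridRect.ext rfl rfl r.2.1.lower_left.symm r.2.1.upper_right.symm))
    exact congrArg EmptyRect.mk this
  exact key y r.target_eq r rfl

theorem GridRect.chain_eq {n : ℕ} (r : GridRect n) (i j : ZMod n) :
    r.chain i j = arcInd r.left r.right i * arcInd r.bottom r.top j := by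
  unfold GridRect.chain arcInd
  split_ifs <;> simp_all

theorem EmptyRect.domain_apply {n : ℕ} [NeZero n] {x y : Gen n} (r : EmptyRect x y)
    (i j : ZMod n) : r.domain.1 i j =
      arcInd r.1.left r.1.right i * arcInd (x r.1.left) (x r.1.right) j := by
  rw [r.2.1.lower_left, r.2.1.upper_right]
  exact r.1.chain_eq i j

theorem Domain.comp_apply {n : ℕ} {x y z : Gen n} (p : Domain x y) (q : Domain y z)
    (i j : ZMod n) : (p.comp q).1 i j = p.1 i j + q.1 i j := rfl

/-! ### The spin extension of the symmetric group -/

/-- Lifts `τ a b` of the transpositions `swap a b` to a ring, subject to the relations of the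
spin extension of the symmetric group in which `-1` is the central element of order two.
Interchanging `a` and `b` changes the sign of `τ a b`. -/
structure IsSpinSystem {ι A : Type*} [Ring A] (τ : ι → ι → A) : Prop where
  symm : ∀ a b, τ b a = -τ a b
  sq : ∀ a b, a ≠ b → τ a b * τ a b = -1
  anticomm : ∀ a b c d, a ≠ b → c ≠ d → a ≠ c → a ≠ d → b ≠ c → b ≠ d →
    τ a b * τ c d = -(τ c d * τ a b)
  rotate : ∀ a b c, a ≠ b → a ≠ c → b ≠ c → τ a b * τ b c = τ b c * τ c a

/-- `IsLift τ s x g`: up to sign, `g` is a product of elements `τ a b` with `a, b ∈ s`, and `x` is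
the corresponding product of transpositions. -/
inductive IsLift {ι A : Type*} [DecidableEq ι] [Ring A] (τ : ι → ι → A) (s : Finset ι) :
    Equiv.Perm ι → A → Prop
  | one : IsLift τ s 1 1
  | neg {x g} : IsLift τ s x g → IsLift τ s x (-g)
  | mul {x g a b} : IsLift τ s x g → a ∈ s → b ∈ s → a ≠ b →
      IsLift τ s (x * Equiv.swap a b) (g * τ a b)

section Lift

variable {ι A : Type*} [DecidableEq ι] [Ring A] {τ : ι → ι → A} {s : Finset ι}
  {x y : Equiv.Perm ι} {g h : A}

theorem IsLift.apply_of_notMem (hg : IsLift τ s x g) {i : ι} (hi : i ∉ s) : x i = i := by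
  induction hg with
  | one => rfl
  | neg _ ih => exact ih
  | mul _ ha hb _ ih =>
    rw [Equiv.Perm.mul_apply, Equiv.swap_apply_of_ne_of_ne, ih]
    · exact fun h => hi (h ▸ ha)
    · exact fun h => hi (h ▸ hb)

theorem IsLift.mul_lift (hg : IsLift τ s x g) (hh : IsLift τ s y h) :
    IsLift τ s (x * y) (g * h) := by
  induction hh with
  | one => simpa using hg
  | neg _ ih => rw [mul_neg]; exact ih.neg
  | mul _ ha hb hab ih => rw [← mul_assoc, ← mul_assoc]; exact ih.mul ha hb hab

theorem IsLift.exists_inv (hτ : IsSpinSystem τ) (hg : IsLift τ s x g) :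
    ∃ g', IsLift τ s x⁻¹ g' ∧ g * g' = 1 ∧ g' * g = 1 := by
  induction hg with
  | one => exact ⟨1, by simpa using IsLift.one, by simp, by simp⟩
  | neg _ ih =>
    obtain ⟨g', h₁, h₂, h₃⟩ := ih
    exact ⟨-g', h₁.neg, by simpa using h₂, by simpa using h₃⟩
  | @mul x g a b _ ha hb hab ih =>
    obtain ⟨g', h₁, h₂, h₃⟩ := ih
    have hsq := hτ.sq a b hab
    refine ⟨-τ a b * g', ?_, ?_, ?_⟩
    · rw [mul_inv_rev, Equiv.swap_inv, neg_mul]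
      have := IsLift.one (τ := τ) |>.mul ha hb hab
      rw [one_mul, one_mul] at this
      exact (this.mul_lift h₁).neg
    · calc g * τ a b * (-τ a b * g') = -(g * (τ a b * τ a b) * g') := by noncomm_ring
        _ = 1 := by rw [hsq]; simpa using h₂
    · calc -τ a b * g' * (g * τ a b) = -(τ a b * (g' * g) * τ a b) := by noncomm_ring
        _ = 1 := by rw [h₃, mul_one, hsq, neg_neg]

/-- Normal form: a lift supported on `insert m s` is a lift supported on `s`, followed by at most
one factor `τ k m`. -/
theorem IsLift.normal_form (hτ : IsSpinSystem τ) {m : ι} (hm : m ∉ s)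
    (hg : IsLift τ (insert m s) x g) :
    IsLift τ s x g ∨ ∃ k ∈ s, ∃ y h, IsLift τ s y h ∧ x = y * Equiv.swap k m ∧ g = h * τ k m := by
  induction hg with
  | one => exact .inl .one
  | neg _ ih =>
    obtain ih | ⟨k, hk, y, h, ih, rfl, rfl⟩ := ih
    · exact .inl ih.neg
    · exact .inr ⟨k, hk, y, -h, ih.neg, rfl, (neg_mul _ _).symm⟩
  | @mul x g a b _ ha hb hab ih =>
    have ne_m {c : ι} (hc : c ∈ s) : c ≠ m := fun h => hm (h ▸ hc)
    -- It suffices to multiply by `τ a b` with `a ∈ s`, because `τ b a = -τ a b`.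
    wlog has : a ∈ s generalizing a b with H
    · obtain rfl : a = m := (Finset.mem_insert.1 ha).resolve_right has
      have hbs : b ∈ s := (Finset.mem_insert.1 hb).resolve_left hab.symm
      rw [Equiv.swap_comm, hτ.symm b a, mul_neg]
      obtain h₁ | ⟨k, hk, y, h, h₁, h₂, h₃⟩ := H hb ha hab.symm hbs
      · exact .inl h₁.neg
      · exact .inr ⟨k, hk, y, -h, h₁.neg, h₂, by rw [h₃, neg_mul]⟩
    obtain ih | ⟨k, hk, y, h, ih, rfl, rfl⟩ := ih
    · obtain rfl | hbs := Finset.mem_insert.1 hb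
      · exact .inr ⟨a, has, x, g, ih, rfl, rfl⟩
      · exact .inl (ih.mul has hbs hab)
    have ham := ne_m has
    have hkm := ne_m hk
    obtain rfl | hbs := Finset.mem_insert.1 hb
    · by_cases hak : a = k
      · subst hak
        left
        rw [mul_assoc, mul_assoc, Equiv.swap_mul_self, hτ.sq _ _ hab, mul_one, mul_neg, mul_one]
        exact ih.neg
      · -- `τ k b * τ a b = -τ a k * τ k b`
        refine .inr ⟨k, hk, _, _, (ih.mul has hk hak).neg, ?_, ?_⟩
        · rw [mul_assoc, mul_assoc]
          congr 1
          ext i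
          simp only [Equiv.Perm.mul_apply, Equiv.swap_apply_def]
          split_ifs <;> simp_all
        · have := hτ.rotate a k b hak hab hkm
          rw [neg_mul, mul_assoc, mul_assoc, this, hτ.symm a b]
          noncomm_ring
    · have hbm := ne_m hbs
      by_cases hak : a = k
      · subst hak
        -- `τ a m * τ a b = -τ a b * τ b m`
        refine .inr ⟨b, hbs, _, _, (ih.mul has hbs hab).neg, ?_, ?_⟩
        · rw [mul_assoc, mul_assoc]
          congr 1
          ext i
          simp only [Equiv.Perm.mul_apply, Equiv.swap_apply_def]
          split_ifs <;> simp_all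
        · have := hτ.rotate m a b ham.symm hbm.symm hab
          rw [neg_mul, mul_assoc, mul_assoc, ← this, hτ.symm m a]
          noncomm_ring
      · by_cases hbk : b = k
        · subst hbk
          -- `τ b m * τ a b = -τ a b * τ a m`
          refine .inr ⟨a, has, _, _, (ih.mul has hbs hab).neg, ?_, ?_⟩
          · rw [mul_assoc, mul_assoc]
            congr 1
            ext i
            simp only [Equiv.Perm.mul_apply, Equiv.swap_apply_def]
            split_ifs <;> simp_all
          · have := hτ.rotate m b a hbm.symm ham.symm hab.symm
            rw [neg_mul, mul_assoc, mul_assoc, hτ.symm b a, hτ.symm m b, neg_mul_neg, this,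
              hτ.symm a b, neg_neg, neg_mul, mul_neg]
        · refine .inr ⟨k, hk, _, _, (ih.mul has hbs hab).neg, ?_, ?_⟩
          · rw [mul_assoc, mul_assoc]
            congr 1
            ext i
            simp only [Equiv.Perm.mul_apply, Equiv.swap_apply_def]
            split_ifs <;> simp_all
          · rw [neg_mul, mul_assoc, mul_assoc,
              hτ.anticomm k m a b hkm hab (Ne.symm hak) (Ne.symm hbk) ham.symm hbm.symm, mul_neg]

/-- The extension is by `±1` only: the lifts of the identity are `1` and `-1`. -/
theorem IsLift.eq_one_or (hτ : IsSpinSystem τ) (hg : IsLift τ s 1 g) : g = 1 ∨ g = -1 := by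
  generalize hx : (1 : Equiv.Perm ι) = x at hg
  induction s using Finset.induction_on generalizing x g with
  | empty =>
    induction hg with
    | one => exact .inl rfl
    | neg _ ih =>
      obtain rfl | rfl := ih hx
      · exact .inr rfl
      · exact .inl (neg_neg 1)
    | mul _ ha => simp at ha
  | insert m s hm ih =>
    obtain h | ⟨k, hk, y, h, hy, rfl, rfl⟩ := hg.normal_form hτ hm
    · exact ih _ hx h
    · have h₁ : y k = m := by
        have := congrArg (· m) hx
        simpa using this.symm
      have h₂ := hy.apply_of_notMem hm
      have : k = m := y.injective (h₁.trans h₂.symm)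
      exact absurd (this ▸ hk) hm

theorem IsLift.eq_or_eq_neg (hτ : IsSpinSystem τ) (hg : IsLift τ s x g) (hh : IsLift τ s x h) :
    g = h ∨ g = -h := by
  obtain ⟨h', h₁, h₂, h₃⟩ := hh.exists_inv hτ
  have := hg.mul_lift h₁
  rw [mul_inv_cancel] at this
  have hgh : g = g * h' * h := by rw [mul_assoc, h₃, mul_one]
  obtain h | h := this.eq_one_or hτ <;> rw [h] at hgh
  · exact .inl (by simpa using hgh)
  · exact .inr (by simpa using hgh)

theorem exists_isLift (τ : ι → ι → A) [Fintype ι] (x : Equiv.Perm ι) :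
    ∃ g, IsLift τ Finset.univ x g := by
  induction x using Equiv.Perm.swap_induction_on' with
  | one => exact ⟨1, .one⟩
  | mul_swap f a b hab ih =>
    obtain ⟨g, hg⟩ := ih
    exact ⟨_, hg.mul (Finset.mem_univ a) (Finset.mem_univ b) hab⟩

end Lift

/-- A choice of lifts of all permutations exhibits the multiplication by lifts of transpositions as
a system of signs. -/
theorem IsSpinSystem.exists_sign {ι A : Type*} [DecidableEq ι] [Fintype ι] [Ring A] [Nontrivial A]
    {τ : ι → ι → A} (hτ : IsSpinSystem τ) :
    ∃ (ρ : Equiv.Perm ι → Aˣ) (σ : Equiv.Perm ι → ι → ι → ℤˣ), ∀ x a b, a ≠ b →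
      (ρ x : A) * τ a b = ((σ x a b : ℤ) : A) * ρ (x * Equiv.swap a b) := by
  choose ρ hρ using exists_isLift τ
  choose ρ' _ hρ₁ hρ₂ using fun x => (hρ x).exists_inv hτ
  classical
  refine ⟨fun x => ⟨ρ x, ρ' x, hρ₁ x, hρ₂ x⟩,
    fun x a b => if ρ x * τ a b = ρ (x * Equiv.swap a b) then 1 else -1, fun x a b hab => ?_⟩
  have h := ((hρ x).mul (Finset.mem_univ a) (Finset.mem_univ b) hab).eq_or_eq_neg hτ (hρ _)
  dsimp only
  split_ifs with h'
  · simpa using h'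
  · simpa using h.resolve_left h'

/-- The spin extension exists: in the Clifford algebra of the form `-½ ∑ vᵢ²` take the vectors
`e_a - e_b`. The factor `½` makes their square `-1` with rational coefficients. -/
theorem exists_isSpinSystem (ι : Type) [DecidableEq ι] [Fintype ι] :
    ∃ (A : Type) (_ : Ring A) (_ : Algebra ℚ A) (_ : Nontrivial A) (τ : ι → ι → A),
      IsSpinSystem τ := by
  let Q : QuadraticForm ℚ (ι → ℚ) := QuadraticMap.weightedSumSquares ℚ fun _ : ι => (-1 / 2 : ℚ)
  let e (i : ι) : ι → ℚ := Pi.single i 1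
  have hQ (v : ι → ℚ) : Q v = ∑ i, (-1 / 2 : ℚ) * (v i * v i) := by
    simp [Q, QuadraticMap.weightedSumSquares_apply]
  have hQe (a b : ι) (hab : a ≠ b) : Q (e a - e b) = -1 := by
    have (i : ι) : (-1 / 2 : ℚ) * ((e a - e b) i * (e a - e b) i) =
        (if i = a then -1 / 2 else 0) + if i = b then -1 / 2 else 0 := by
      simp only [e, Pi.sub_apply, Pi.single_apply]
      split_ifs <;> simp_all
    rw [hQ, Finset.sum_congr rfl fun i _ => this i, Finset.sum_add_distrib]
    norm_num
  let τ (a b : ι) : CliffordAlgebra Q := CliffordAlgebra.ι Q (e a - e b)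
  have hsymm (a b : ι) : τ b a = -τ a b := by
    simp only [τ, ← map_neg, neg_sub]
  have hsq (a b : ι) (hab : a ≠ b) : τ a b * τ a b = -1 := by
    simp only [τ, CliffordAlgebra.ι_sq_scalar, hQe a b hab, map_neg, map_one]
  refine ⟨CliffordAlgebra Q, inferInstance, inferInstance, ?_, τ, hsymm, hsq, ?_, ?_⟩
  · have : Invertible (2 : ℚ) := invertibleOfNonzero two_ne_zero
    infer_instance
  · intro a b c d hab hcd hac had hbc hbd
    have hpolar : QuadraticMap.polar Q (e a - e b) (e c - e d) = 0 := by
      simp only [QuadraticMap.polar, hQ, ← Finset.sum_sub_distrib]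
      refine Finset.sum_eq_zero fun i _ => ?_
      have : (e a - e b) i * (e c - e d) i = 0 := by
        rw [mul_eq_zero]
        simp only [e, Pi.sub_apply]
        by_cases hi : i = a ∨ i = b
        · right
          obtain rfl | rfl := hi
          · rw [Pi.single_eq_of_ne hac, Pi.single_eq_of_ne had, sub_self]
          · rw [Pi.single_eq_of_ne hbc, Pi.single_eq_of_ne hbd, sub_self]
        · left
          rw [not_or] at hi
          rw [Pi.single_eq_of_ne hi.1, Pi.single_eq_of_ne hi.2, sub_self]
      rw [Pi.add_apply]
      linear_combination -this
    rw [eq_neg_iff_add_eq_zero]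
    simp only [τ, CliffordAlgebra.ι_mul_ι_add_swap, hpolar, map_zero]
  · intro a b c hab hac hbc
    have h₁ : τ a c = τ a b + τ b c := by simp only [τ, ← map_add, sub_add_sub_cancel]
    have h₂ : τ c a = -(τ a b + τ b c) := by rw [hsymm a c, h₁]
    -- The square of `τ a c = τ a b + τ b c` gives the anticommutator of the summands.
    have h₃ := hsq a c hac
    rw [h₁, add_mul, mul_add, mul_add, hsq a b hab, hsq b c hbc] at h₃
    rw [h₂, mul_neg, mul_add, hsq b c hbc]
    have h₄ : τ a b * τ b c + τ b c * τ a b = 1 := by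
      have : τ a b * τ b c + τ b c * τ a b =
          (-1 + τ a b * τ b c + (τ b c * τ a b + -1)) + 1 + 1 := by abel
      rw [this, h₃]; abel
    rw [← h₄]; abel

/-! ### Two successive rectangles -/

section Swap

variable {α : Type*} [DecidableEq α] {a b c d a' b' c' d' : α}

/-- A product of two different transpositions moves every point that one of them moves. -/
theorem swap_swap_apply_ne (hab : a ≠ b) (hcd : c ≠ d) (h₁ : ¬ (c = a ∧ d = b))
    (h₂ : ¬ (c = b ∧ d = a)) {t : α} (ht : t = a ∨ t = b ∨ t = c ∨ t = d) :
    Equiv.swap a b (Equiv.swap c d t) ≠ t := by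
  simp only [Equiv.swap_apply_def]
  grind

/-- The factors of a product of two disjoint transpositions are unique up to their order. -/
theorem disjoint_swap_swap_unique (hab : a ≠ b) (hcd : c ≠ d) (hac : a ≠ c) (had : a ≠ d)
    (hbc : b ≠ c) (hbd : b ≠ d) (hab' : a' ≠ b') (hcd' : c' ≠ d')
    (h : ∀ t, Equiv.swap a b (Equiv.swap c d t) = Equiv.swap a' b' (Equiv.swap c' d' t)) :
    (a' = a ∧ b' = b ∨ a' = b ∧ b' = a) ∧ (c' = c ∧ d' = d ∨ c' = d ∧ d' = c) ∨
      (a' = c ∧ b' = d ∨ a' = d ∧ b' = c) ∧ (c' = a ∧ d' = b ∨ c' = b ∧ d' = a) := by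
  have h₁ := h a
  have h₂ := h b
  have h₃ := h c
  have h₄ := h d
  clear h
  simp only [Equiv.swap_apply_def] at *
  grind (splits := 20)

theorem swap_swap_apply_self (h : c = a ∧ d = b ∨ c = b ∧ d = a) (t : α) :
    Equiv.swap a b (Equiv.swap c d t) = t := by
  obtain ⟨rfl, rfl⟩ | ⟨rfl, rfl⟩ := h
  · rw [← Equiv.Perm.mul_apply, Equiv.swap_mul_self, Equiv.Perm.one_apply]
  · rw [Equiv.swap_comm, ← Equiv.Perm.mul_apply, Equiv.swap_mul_self, Equiv.Perm.one_apply]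

/-- Two transpositions whose product is trivial are equal. -/
theorem swap_eq_of_swap_swap_eq_one (hab : a ≠ b) (hcd : c ≠ d)
    (h : ∀ t, Equiv.swap a b (Equiv.swap c d t) = t) : c = a ∧ d = b ∨ c = b ∧ d = a := by
  by_contra hne
  rw [not_or] at hne
  exact swap_swap_apply_ne hab hcd hne.1 hne.2 (.inl rfl) (h a)

end Swap

section Three

/-- The arcs between three points of a circle, labelled by `Fin 3` in the cyclic order (`q` true)
or against it (`q` false). -/
def inArc3 (q : Bool) (a b c : Fin 3) : Bool :=
  if q then (c - a).val < (b - a).val else (a - c).val < (a - b).val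

theorem exists_inArc3 {n : ℕ} [NeZero n] {u : Fin 3 → ZMod n} (hu : u.Injective) :
    ∃ q, ∀ a b c, InArc (u a) (u b) (u c) ↔ inArc3 q a b c = true := by
  have h₁ : (u 0).val ≠ (u 1).val := fun h => by simpa using hu (ZMod.val_injective n h)
  have h₂ : (u 0).val ≠ (u 2).val := fun h => by simpa using hu (ZMod.val_injective n h)
  have h₃ : (u 1).val ≠ (u 2).val := fun h => by simpa using hu (ZMod.val_injective n h)
  have h₀ : (-2 : Fin 3) = 1 := rfl
  by_cases h : InArc (u 0) (u 2) (u 1)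
  · refine ⟨true, fun a b c => ?_⟩
    rw [inArc_iff] at h ⊢
    fin_cases a <;> fin_cases b <;> fin_cases c <;> simp [inArc3, h₀] <;> omega
  · refine ⟨false, fun a b c => ?_⟩
    rw [inArc_iff] at h ⊢
    fin_cases a <;> fin_cases b <;> fin_cases c <;> simp [inArc3, h₀] <;> omega

/-- The multiplicity at the cell `(s, t)` of the rectangle `[a, b] × [c, d]`. -/
def chain3 (p q : Bool) (a b c d s t : Fin 3) : ℕ :=
  (inArc3 p a b s && inArc3 q c d t).toNat

/-- The rectangle `[a, b] × [c, d]` contains none of the points `(m, x m)` in its interior. -/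
abbrev Empty3 (p q : Bool) (a b c d : Fin 3) (x : Fin 3 → Fin 3) : Prop :=
  ∀ m, ¬ ((m ≠ a ∧ inArc3 p a b m) ∧ x m ≠ c ∧ inArc3 q c d (x m))

/-- The sign of the orientation of the pair `(a, b)` with respect to the cyclic order `0, 1, 2`. -/
def sign3 (a b : Fin 3) : ℤ := if b = a + 1 then 1 else -1

set_option maxRecDepth 100000 in
set_option synthInstance.maxSize 10000 in
set_option synthInstance.maxHeartbeats 1000000 in
/-- A finite check for L-shaped domains: two decompositions of such a domain into empty rectangles
have opposite orientation signs. Here `p` and `q` stand for the cyclic orders of the three columns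
and the three rows involved, and the point of the initial generator in column `m` is `(m, m)`. -/
theorem sign3_decomposition : ∀ p q : Bool, ∀ a b : Fin 3, a ≠ b → Empty3 p q a b a b id →
    ∀ c d : Fin 3, c ≠ d → ¬ (c = a ∧ d = b) → ¬ (c = b ∧ d = a) →
    Empty3 p q c d (Equiv.swap a b c) (Equiv.swap a b d) (Equiv.swap a b) →
    ∀ a' b' : Fin 3, a' ≠ b' → ¬ (a' = a ∧ b' = b) → ∀ c' d' : Fin 3, c' ≠ d' →
    (∀ t, Equiv.swap a b (Equiv.swap c d t) = Equiv.swap a' b' (Equiv.swap c' d' t)) →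
    (∀ s t, chain3 p q a b a b s t +
        chain3 p q c d (Equiv.swap a b c) (Equiv.swap a b d) s t =
      chain3 p q a' b' a' b' s t +
        chain3 p q c' d' (Equiv.swap a' b' c') (Equiv.swap a' b' d') s t) →
    sign3 a b * sign3 c d = -(sign3 a' b' * sign3 c' d') ∧
      (a + b) - (c + d) = (a' + b') - (c' + d') := by
  decide +kernel

/-- Lifts of transpositions in three letters: up to the orientation sign, the product of two of
them depends only on the product of the transpositions. -/
theorem IsSpinSystem.mul_eq_of_three {ι A : Type*} [Ring A] {τ : ι → ι → A} (hτ : IsSpinSystem τ)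
    {u : Fin 3 → ι} (hu : u.Injective) {a b c d a' b' c' d' : Fin 3} (hab : a ≠ b) (hcd : c ≠ d)
    (hab' : a' ≠ b') (hcd' : c' ≠ d') (h₁ : ¬ (c = a ∧ d = b)) (h₂ : ¬ (c = b ∧ d = a))
    (hsign : sign3 a b * sign3 c d = -(sign3 a' b' * sign3 c' d'))
    (hsum : (a + b) - (c + d) = (a' + b') - (c' + d')) :
    τ (u a) (u b) * τ (u c) (u d) = -(τ (u a') (u b') * τ (u c') (u d')) := by
  have h01 : u 0 ≠ u 1 := hu.ne (by decide)
  have h02 : u 0 ≠ u 2 := hu.ne (by decide)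
  have h12 : u 1 ≠ u 2 := hu.ne (by decide)
  -- `T m` is the positively oriented lift of the transposition that fixes `m`.
  let T (m : Fin 3) : A := τ (u (m + 1)) (u (m + 2))
  have hT (a b : Fin 3) (hab : a ≠ b) : τ (u a) (u b) = sign3 a b • T (-(a + b)) := by
    have e₁ := hτ.symm (u 0) (u 1)
    have e₂ := hτ.symm (u 1) (u 2)
    have e₃ := hτ.symm (u 2) (u 0)
    fin_cases a <;> fin_cases b <;> first | exact absurd rfl hab | skip
    · exact (one_smul ℤ _).symm
    · exact e₃.trans (neg_one_smul ℤ _).symm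
    · exact e₁.trans (neg_one_smul ℤ _).symm
    · exact (one_smul ℤ _).symm
    · exact (one_smul ℤ _).symm
    · exact e₂.trans (neg_one_smul ℤ _).symm
  have hTT (m k : Fin 3) (hk : k ≠ 0) : T m * T (m + k) = T 0 * T k := by
    have f₁ : T 0 * T 1 = T 1 * T 2 := hτ.rotate (u 1) (u 2) (u 0) h12 h01.symm h02.symm
    have f₂ : T 1 * T 2 = T 2 * T 0 := hτ.rotate (u 2) (u 0) (u 1) h02.symm h12.symm h01
    have f₃ : T 0 * T 2 = T 2 * T 1 := by
      have := hτ.rotate (u 2) (u 1) (u 0) h12.symm h02.symm h01.symm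
      rw [hτ.symm (u 1) (u 2), hτ.symm (u 0) (u 1), hτ.symm (u 2) (u 0), neg_mul_neg,
        neg_mul_neg] at this
      exact this
    have f₄ : T 2 * T 1 = T 1 * T 0 := by
      have := hτ.rotate (u 1) (u 0) (u 2) h01.symm h12 h02
      rw [hτ.symm (u 1) (u 2), hτ.symm (u 0) (u 1), hτ.symm (u 2) (u 0), neg_mul_neg,
        neg_mul_neg] at this
      exact this
    fin_cases m <;> fin_cases k <;> first | exact absurd rfl hk | skip
    · rfl
    · rfl
    · exact f₁.symm
    · exact f₄.symm.trans f₃.symm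
    · exact (f₁.trans f₂).symm
    · exact f₃.symm
  have hk : ∀ a b c d : Fin 3, a ≠ b → c ≠ d → ¬ (c = a ∧ d = b) → ¬ (c = b ∧ d = a) →
      (a + b) - (c + d) ≠ 0 := by decide
  have hk' := hk a b c d hab hcd h₁ h₂
  have key (a b c d : Fin 3) (hab : a ≠ b) (hcd : c ≠ d) (hk : (a + b) - (c + d) ≠ 0) :
      τ (u a) (u b) * τ (u c) (u d) =
        (sign3 a b * sign3 c d) • (T 0 * T ((a + b) - (c + d))) := by
    rw [hT a b hab, hT c d hcd, ← hTT (-(a + b)) _ hk, smul_mul_smul_comm]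
    congr 3
    abel
  rw [key a b c d hab hcd hk', key a' b' c' d' hab' hcd' (hsum ▸ hk'), hsign, hsum, neg_smul]

end Three

/-! ### Existence -/

/-- A domain without horizontal boundary edges, or without vertical ones, does not move the
generator. -/
theorem Domain.eq_of_const {n : ℕ} {x z : Gen n} (p : Domain x z)
    (h : (∀ i j, p.1 i j = p.1 i 0) ∨ ∀ i j, p.1 i j = p.1 0 j) : z = x := by
  ext i : 1
  have hp := p.2 i (x i)
  simp only [vertexBoundary, TwoChain.horizontalBoundary, Gen.zeroChain, if_true] at hp
  by_contra hne
  rw [if_neg hne] at hp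
  obtain h | h := h
  · rw [h i (x i), h i (x i - 1), h (i - 1) (x i), h (i - 1) (x i - 1)] at hp
    omega
  · rw [h i (x i), h i (x i - 1), h (i - 1) (x i), h (i - 1) (x i - 1)] at hp
    omega

theorem swap_eq_of_returns {n : ℕ} {x y : Gen n} {a b c d : ZMod n} (hab : a ≠ b) (hcd : c ≠ d)
    (hy : y = x * Equiv.swap a b) (hx : x = y * Equiv.swap c d) :
    c = a ∧ d = b ∨ c = b ∧ d = a := by
  refine swap_eq_of_swap_swap_eq_one hab hcd fun t => x.injective ?_
  subst hy
  simpa only [Equiv.Perm.mul_apply] using (Equiv.congr_fun hx t).symm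

section Existence

variable {n : ℕ} [NeZero n] {A : Type*} [Ring A] {τ : ZMod n → ZMod n → A}

/-- The multiplicity in the cell `(i, j)` of the composite of the rectangle from `x` with vertical
edges `a, b` and the rectangle from `y` with vertical edges `c, d`. -/
def compChain (x y : Gen n) (a b c d i j : ZMod n) : ℤ :=
  arcInd a b i * arcInd (x a) (x b) j + arcInd c d i * arcInd (y c) (y d) j

theorem compChain_vertical (x : Gen n) {a b : ZMod n} (hab : a ≠ b) (i j : ZMod n) :
    compChain x (x * Equiv.swap a b) a b a b i j = arcInd a b i := by
  simp only [compChain, Equiv.Perm.mul_apply, Equiv.swap_apply_left, Equiv.swap_apply_right,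
    arcInd_compl (x.injective.ne hab)]
  ring

theorem compChain_horizontal (x : Gen n) {a b : ZMod n} (hab : a ≠ b) (i j : ZMod n) :
    compChain x (x * Equiv.swap a b) a b b a i j = arcInd (x a) (x b) j := by
  simp only [compChain, Equiv.Perm.mul_apply, Equiv.swap_apply_left, Equiv.swap_apply_right,
    arcInd_compl hab]
  ring

/-- The annulus that two rectangles with the same pair of columns form determines its
decomposition. -/
theorem compChain_inj_of_eq {x : Gen n} {a b c d a' b' c' d' : ZMod n} (hab : a ≠ b)
    (hab' : a' ≠ b') (hcd : c = a ∧ d = b ∨ c = b ∧ d = a)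
    (hcd' : c' = a' ∧ d' = b' ∨ c' = b' ∧ d' = a')
    (h : ∀ i j, compChain x (x * Equiv.swap a b) a b c d i j =
      compChain x (x * Equiv.swap a' b') a' b' c' d' i j) : a' = a ∧ b' = b := by
  obtain ⟨rfl, rfl⟩ | ⟨rfl, rfl⟩ := hcd <;> obtain ⟨rfl, rfl⟩ | ⟨rfl, rfl⟩ := hcd' <;>
    simp only [compChain_vertical x hab, compChain_vertical x hab', compChain_horizontal x hab,
      compChain_horizontal x hab'] at h
  · exact arcInd_injective hab' hab fun i => (h i 0).symm
  · have h₁ := (h c (x c')).trans (h d (x c')).symm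
    rw [arcInd_left hab, arcInd_right] at h₁
    omega
  · have h₂ := h c' (x d)
    have h₃ := h d' (x d)
    rw [arcInd_left hab'] at h₂
    rw [arcInd_right] at h₃
    omega
  · obtain ⟨h₁, h₂⟩ := arcInd_injective (x.injective.ne hab') (x.injective.ne hab)
      fun j => (h 0 j).symm
    exact ⟨x.injective h₁, x.injective h₂⟩

/-- The case of two rectangles without a common column: the same two rectangles, with the same
orientations, occur in the opposite order in the other decomposition. -/
theorem IsSpinSystem.square_of_disjoint (hτ : IsSpinSystem τ) {x : Gen n}
    {a b c d a' b' c' d' : ZMod n} (hab : a ≠ b) (hcd : c ≠ d) (hac : a ≠ c) (had : a ≠ d)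
    (hbc : b ≠ c) (hbd : b ≠ d) (hab' : a' ≠ b') (hcd' : c' ≠ d')
    (hperm : ∀ t, Equiv.swap a b (Equiv.swap c d t) = Equiv.swap a' b' (Equiv.swap c' d' t))
    (h : ∀ i j, compChain x (x * Equiv.swap a b) a b c d i j =
      compChain x (x * Equiv.swap a' b') a' b' c' d' i j) (hne : ¬ (a' = a ∧ b' = b)) :
    τ a b * τ c d = -(τ a' b' * τ c' d') := by
  have hsc : Equiv.swap a b c = c := Equiv.swap_apply_of_ne_of_ne hac.symm hbc.symm
  have hsd : Equiv.swap a b d = d := Equiv.swap_apply_of_ne_of_ne had.symm hbd.symm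
  have hsa : Equiv.swap c d a = a := Equiv.swap_apply_of_ne_of_ne hac had
  have hsb : Equiv.swap c d b = b := Equiv.swap_apply_of_ne_of_ne hbc hbd
  -- The jump across a column that is an edge of only one rectangle tells its orientation.
  have jump (i j : ZMod n) := congrArg₂ (· - ·) (h i j) (h (i - 1) j)
  simp only [compChain, add_sub_add_comm, ← sub_mul, arcInd_step hab, arcInd_step hcd,
    arcInd_step hab', arcInd_step hcd', Equiv.Perm.mul_apply, hsc, hsd] at jump
  have ja := jump a (x a)
  have jc := jump c (x c)
  have hxab := arcInd_left (x.injective.ne hab)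
  have hxcd := arcInd_left (x.injective.ne hcd)
  obtain ⟨h₁ | h₁, h₂ | h₂⟩ | ⟨h₁ | h₁, h₂ | h₂⟩ :=
    disjoint_swap_swap_unique hab hcd hac had hbc hbd hab' hcd' hperm
  iterate 2 exact absurd h₁ hne
  all_goals obtain ⟨rfl, rfl⟩ := h₁; obtain ⟨rfl, rfl⟩ := h₂
  · simp [hab, hac, had, hxab, arcInd_right] at ja
  · simp [hab, hac, had, hxab, arcInd_right] at ja
  · exact hτ.anticomm _ _ _ _ hab hcd hac had hbc hbd
  · simp [hab, hac, had, hsa, hsb, hxab, arcInd_right] at ja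
  · simp [hcd, hac.symm, hbc.symm, hxcd, arcInd_right] at jc
  · rw [Equiv.swap_comm a' b', hsa, hsb] at ja
    simp [hab, hac, had, hxab, arcInd_right] at ja

/-- The case of two rectangles with one common column: the three columns and the three rows involved
are labelled by `Fin 3`, which reduces the claim to `sign3_decomposition`. -/
theorem IsSpinSystem.square_of_three (hτ : IsSpinSystem τ) {x : Gen n}
    {u : Fin 3 → ZMod n} (hu : u.Injective) {a b c d a' b' c' d' : Fin 3}
    (h₁ : x.HasRect (u a) (u b)) (h₂ : (x * Equiv.swap (u a) (u b)).HasRect (u c) (u d))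
    (hab' : a' ≠ b') (hcd' : c' ≠ d') (hca : ¬ (c = a ∧ d = b)) (hcb : ¬ (c = b ∧ d = a))
    (hne : ¬ (a' = a ∧ b' = b))
    (hperm : ∀ t, Equiv.swap (u a) (u b) (Equiv.swap (u c) (u d) t) =
      Equiv.swap (u a') (u b') (Equiv.swap (u c') (u d') t))
    (h : ∀ i j, compChain x (x * Equiv.swap (u a) (u b)) (u a) (u b) (u c) (u d) i j =
      compChain x (x * Equiv.swap (u a') (u b')) (u a') (u b') (u c') (u d') i j) :
    τ (u a) (u b) * τ (u c) (u d) = -(τ (u a') (u b') * τ (u c') (u d')) := by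
  have hab : a ≠ b := fun h => h₁.ne (congrArg u h)
  have hcd : c ≠ d := fun h => h₂.ne (congrArg u h)
  have hsw (a b t : Fin 3) : Equiv.swap (u a) (u b) (u t) = u (Equiv.swap a b t) :=
    hu.swap_apply a b t
  obtain ⟨p, hp⟩ := exists_inArc3 hu
  obtain ⟨q, hq⟩ := exists_inArc3 (x.injective.comp hu)
  simp only [Function.comp_apply] at hq
  have hchain (a b c d s t : Fin 3) : arcInd (u a) (u b) (u s) *
      arcInd (x (u c)) (x (u d)) (x (u t)) = chain3 p q a b c d s t := by
    simp only [arcInd, hp, hq, chain3]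
    cases inArc3 p a b s <;> cases inArc3 q c d t <;> rfl
  obtain ⟨hsign, hsum⟩ := sign3_decomposition p q a b hab
    (fun m hm => h₁.empty (u m) ⟨⟨hu.ne hm.1.1, (hp a b m).2 hm.1.2⟩,
      (x.injective.comp hu).ne hm.2.1, (hq a b m).2 hm.2.2⟩)
    c d hcd hca hcb
    (fun m hm => h₂.empty (u m) ⟨⟨hu.ne hm.1.1, (hp c d m).2 hm.1.2⟩, by
      simp only [InOpenArc, Equiv.Perm.mul_apply, hsw]
      exact ⟨(x.injective.comp hu).ne hm.2.1, (hq _ _ _).2 hm.2.2⟩⟩)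
    a' b' hab' hne c' d' hcd' (fun t => hu (by simpa only [hsw] using hperm (u t)))
    (fun s t => by
      have := h (u s) (x (u t))
      simp only [compChain, Equiv.Perm.mul_apply, hsw, hchain] at this
      exact_mod_cast this)
  exact hτ.mul_eq_of_three hu hab hcd hab' hcd' hca hcb hsign hsum

/-- Along two different decompositions of a domain into two empty rectangles, the lifts of the
transpositions anticommute. -/
theorem IsSpinSystem.square (hτ : IsSpinSystem τ) {x y y' z : Gen n}
    {a b c d a' b' c' d' : ZMod n} (h₁ : x.HasRect a b) (hy : y = x * Equiv.swap a b)
    (h₂ : y.HasRect c d) (hz : z = y * Equiv.swap c d) (h₁' : x.HasRect a' b')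
    (hy' : y' = x * Equiv.swap a' b') (h₂' : y'.HasRect c' d') (hz' : z = y' * Equiv.swap c' d')
    (h : ∀ i j, compChain x y a b c d i j = compChain x y' a' b' c' d' i j)
    (hne : ¬ (a' = a ∧ b' = b)) :
    τ a b * τ c d = -(τ a' b' * τ c' d') := by
  subst hy hy' hz
  have hperm (t : ZMod n) : Equiv.swap a b (Equiv.swap c d t) =
      Equiv.swap a' b' (Equiv.swap c' d' t) := by
    have := Equiv.congr_fun hz' t
    simpa only [Equiv.Perm.mul_apply, x.injective.eq_iff] using this
  have hab := h₁.ne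
  have hcd := h₂.ne
  have hab' := h₁'.ne
  have hcd' := h₂'.ne
  by_cases hca : c = a ∧ d = b ∨ c = b ∧ d = a
  · refine absurd (compChain_inj_of_eq hab hab' hca ?_ h) hne
    exact swap_eq_of_swap_swap_eq_one hab' hcd' fun t => by
      rw [← hperm, swap_swap_apply_self hca]
  by_cases hdis : a ≠ c ∧ a ≠ d ∧ b ≠ c ∧ b ≠ d
  · obtain ⟨hac, had, hbc, hbd⟩ := hdis
    exact hτ.square_of_disjoint hab hcd hac had hbc hbd hab' hcd' hperm h hne
  -- Now the two pairs of columns have one column in common.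
  obtain ⟨e, hea, heb, hc, hd⟩ : ∃ e, e ≠ a ∧ e ≠ b ∧ (c = a ∨ c = b ∨ c = e) ∧
      (d = a ∨ d = b ∨ d = e) := by
    by_cases h : c = a ∨ c = b
    · refine ⟨d, ?_, ?_, ?_, .inr (.inr rfl)⟩ <;> grind
    · exact ⟨c, by grind, by grind, .inr (.inr rfl), by grind⟩
  rw [not_or] at hca
  have hmem (t : ZMod n) (ht : Equiv.swap a b (Equiv.swap c d t) ≠ t) :
      t = a ∨ t = b ∨ t = e := by
    by_contra hcon
    rw [Equiv.swap_apply_of_ne_of_ne (a := c), Equiv.swap_apply_of_ne_of_ne] at ht <;> grind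
  have hca' : ¬ (c' = a' ∧ d' = b' ∨ c' = b' ∧ d' = a') := by
    intro h
    refine swap_swap_apply_ne hab hcd hca.1 hca.2 (.inl rfl) ?_
    rw [hperm, swap_swap_apply_self h]
  rw [not_or] at hca'
  have hmem' (t : ZMod n) (ht : t = a' ∨ t = b' ∨ t = c' ∨ t = d') : t = a ∨ t = b ∨ t = e :=
    hmem t (by rw [hperm]; exact swap_swap_apply_ne hab' hcd' hca'.1 hca'.2 ht)
  let u : Fin 3 → ZMod n := ![a, b, e]
  have hu : u.Injective := by
    intro i j hij
    fin_cases i <;> fin_cases j <;> simp_all [u]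
  have hrange {t : ZMod n} (ht : t = a ∨ t = b ∨ t = e) : ∃ i, u i = t := by
    obtain rfl | rfl | rfl := ht
    exacts [⟨0, rfl⟩, ⟨1, rfl⟩, ⟨2, rfl⟩]
  obtain ⟨ia, ha⟩ := hrange (t := a) (.inl rfl)
  obtain ⟨ib, hb⟩ := hrange (t := b) (.inr (.inl rfl))
  obtain ⟨ic, rfl⟩ := hrange hc
  obtain ⟨id, rfl⟩ := hrange hd
  obtain ⟨ia', rfl⟩ := hrange (hmem' a' (by simp))
  obtain ⟨ib', rfl⟩ := hrange (hmem' b' (by simp))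
  obtain ⟨ic', rfl⟩ := hrange (hmem' c' (by simp))
  obtain ⟨id', rfl⟩ := hrange (hmem' d' (by simp))
  clear_value u
  subst ha hb
  simp only [hu.eq_iff] at *
  exact hτ.square_of_three hu h₁ h₂ (fun h => hab' (congrArg u h))
    (fun h => hcd' (congrArg u h)) hca.1 hca.2 hne hperm h

theorem EmptyRect.comp_domain_apply {x y z : Gen n} (r₁ : EmptyRect x y) (r₂ : EmptyRect y z)
    (i j : ZMod n) : (r₁.domain.comp r₂.domain).1 i j =
      compChain x y r₁.1.left r₁.1.right r₂.1.left r₂.1.right i j := by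
  rw [Domain.comp_apply, r₁.domain_apply, r₂.domain_apply, compChain]

theorem eq_of_isVerticalAnnulus {x y : Gen n} {a b c d : ZMod n} (hab : a ≠ b) (hcd : c ≠ d)
    (hy : y = x * Equiv.swap a b) (hx : x = y * Equiv.swap c d)
    (h : TwoChain.IsVerticalAnnulus fun i j => compChain x y a b c d i j) : c = a ∧ d = b := by
  obtain ⟨l, r, -, h⟩ := h
  refine (swap_eq_of_returns hab hcd hy hx).resolve_right ?_
  rintro ⟨rfl, rfl⟩
  subst hy
  simp only [compChain_horizontal x hab] at h
  have h₁ := (h 0 (x d)).trans (h 0 (x c)).symm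
  rw [arcInd_left (x.injective.ne hab), arcInd_right] at h₁
  omega

theorem eq_of_isHorizontalAnnulus {x y : Gen n} {a b c d : ZMod n} (hab : a ≠ b) (hcd : c ≠ d)
    (hy : y = x * Equiv.swap a b) (hx : x = y * Equiv.swap c d)
    (h : TwoChain.IsHorizontalAnnulus fun i j => compChain x y a b c d i j) :
    c = b ∧ d = a := by
  obtain ⟨l, r, -, h⟩ := h
  refine (swap_eq_of_returns hab hcd hy hx).resolve_left ?_
  rintro ⟨rfl, rfl⟩
  subst hy
  simp only [compChain_vertical x hab] at h
  have h₁ := (h c 0).trans (h d 0).symm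
  rw [arcInd_left hab, arcInd_right] at h₁
  omega

/-- The sign of a rectangle from `x` to `y` compares the lift of `x`, multiplied by the lift of the
transposition of the left and the right edge (in this order), with the lift of `y`. -/
theorem exists_isSignAssignment (n : ℕ) [NeZero n] :
    ∃ S : EmptyRects n → ℤˣ, IsSignAssignment S := by
  obtain ⟨A, _, _, _, τ, hτ⟩ := exists_isSpinSystem (ZMod n)
  obtain ⟨ρ, σ, hσ⟩ := hτ.exists_sign
  let S (r : EmptyRects n) : ℤˣ := σ r.1 r.2.2.1.left r.2.2.1.right
  have hS {x y : Gen n} (r : EmptyRect x y) :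
      (ρ x : A) * τ r.1.left r.1.right = ((S r.mk : ℤ) : A) * ρ y := by
    have := hσ x _ _ r.1.left_ne_right
    rwa [← r.target_eq] at this
  have hSS {x y z : Gen n} (r₁ : EmptyRect x y) (r₂ : EmptyRect y z) :
      (ρ x : A) * (τ r₁.1.left r₁.1.right * τ r₂.1.left r₂.1.right) =
        (((S r₁.mk * S r₂.mk : ℤˣ) : ℤ) : A) * ρ z := by
    rw [← mul_assoc, hS, mul_assoc, hS, ← mul_assoc, Units.val_mul, Int.cast_mul]
  have : CharZero A := algebraRat.charZero A
  have inj {e e' : ℤˣ} {x : Gen n} (h : ((e : ℤ) : A) * ρ x = ((e' : ℤ) : A) * ρ x) : e = e' :=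
    Units.ext (Int.cast_injective (α := A) ((ρ x).isUnit.mul_right_cancel h))
  refine ⟨S, ⟨fun x y y' z r₁ r₂ r₁' r₂' hnd h => ?_, fun x y z r₁ r₂ h => ?_,
    fun x y z r₁ r₂ h => ?_⟩⟩
  · have hchain (i j : ZMod n) := congrFun (congrFun (congrArg Subtype.val h) i) j
    simp only [EmptyRect.comp_domain_apply] at hchain
    have key := hτ.square r₁.hasRect r₁.target_eq r₂.hasRect r₂.target_eq r₁'.hasRect
      r₁'.target_eq r₂'.hasRect r₂'.target_eq hchain ?_
    · apply inj (x := z)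
      rw [← hSS, key, mul_neg, hSS, Units.val_neg, Int.cast_neg, neg_mul]
    · rintro ⟨hl, hr⟩
      have hmk : r₁'.mk = r₁.mk := by
        obtain rfl : y' = y := by rw [r₁'.target_eq, r₁.target_eq, hl, hr]
        have : r₁' = r₁ := Subtype.ext (GridRect.ext hl hr
          (by rw [← r₁'.2.1.lower_left, ← r₁.2.1.lower_left, hl])
          (by rw [← r₁'.2.1.upper_right, ← r₁.2.1.upper_right, hr]))
        rw [this]
      simp [hmk] at hnd
  · obtain rfl : z = x := by
      obtain ⟨l, r, -, h⟩ := h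
      exact Domain.eq_of_const _ (.inl fun i j => by rw [h, h])
    have h' : TwoChain.IsVerticalAnnulus fun i j =>
        compChain z y r₁.1.left r₁.1.right r₂.1.left r₂.1.right i j := by
      simpa only [← EmptyRect.comp_domain_apply] using h
    obtain ⟨hl, hr⟩ := eq_of_isVerticalAnnulus r₁.1.left_ne_right r₂.1.left_ne_right r₁.target_eq
      r₂.target_eq h'
    apply inj (x := z)
    rw [← hSS, hl, hr, hτ.sq _ _ r₁.1.left_ne_right]
    simp
  · obtain rfl : z = x := by
      obtain ⟨l, r, -, h⟩ := h
      exact Domain.eq_of_const _ (.inr fun i j => by rw [h, h])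
    have h' : TwoChain.IsHorizontalAnnulus fun i j =>
        compChain z y r₁.1.left r₁.1.right r₂.1.left r₂.1.right i j := by
      simpa only [← EmptyRect.comp_domain_apply] using h
    obtain ⟨hl, hr⟩ := eq_of_isHorizontalAnnulus r₁.1.left_ne_right r₂.1.left_ne_right
      r₁.target_eq r₂.target_eq h'
    apply inj (x := z)
    rw [← hSS, hl, hr, hτ.symm r₁.1.left, mul_neg, hτ.sq _ _ r₁.1.left_ne_right]
    simp

end Existence

/-! ### Rectangles of width or height one -/

theorem eq_of_inArc_succ {n : ℕ} {i t : ZMod n} (h : InArc i (i + 1) t) : t = i := by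
  have h₁ : (i + 1 - i).val ≤ 1 := by
    rw [add_sub_cancel_left, ZMod.val_one_eq_one_mod]
    exact Nat.mod_le 1 n
  have h₂ : (t - i).val = 0 := by
    have : (t - i).val < (i + 1 - i).val := h
    omega
  exact sub_eq_zero.1 ((ZMod.val_eq_zero _).1 h₂)

/-- Rectangles of width one are empty. -/
theorem Gen.hasRect_succ {n : ℕ} (x : Gen n) {i : ZMod n} (hi : i ≠ i + 1) : x.HasRect i (i + 1) :=
  ⟨hi, fun _ ht => ht.1.1 (eq_of_inArc_succ ht.1.2)⟩

/-- Rectangles of height one are empty. -/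
theorem Gen.hasRect_of_row_succ {n : ℕ} (x : Gen n) {a b : ZMod n} (hab : a ≠ b)
    (h : x b = x a + 1) : x.HasRect a b :=
  ⟨hab, fun _ ht => ht.2.1 (eq_of_inArc_succ (h ▸ ht.2.2))⟩

section Thin

variable {n : ℕ} [NeZero n]

theorem inArc_split {a c t : ZMod n} (b : ZMod n) (ht : InArc a c t) :
    InArc a b t ∨ InArc b c t := by
  simp only [inArc_iff] at ht ⊢
  omega

theorem InOpenArc.ne {a b c : ZMod n} (hc : InOpenArc a b c) : c ≠ a ∧ c ≠ b ∧ a ≠ b := by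
  have h := hc.2
  refine ⟨hc.1, fun hcb => not_inArc_right (hcb ▸ h), fun hab => ?_⟩
  rw [hab, inArc_iff] at h
  omega

theorem InOpenArc.rotate {a b c : ZMod n} (h : InOpenArc a c b) : InOpenArc b a c := by
  obtain ⟨h₁, h₂, h₃⟩ := h.ne
  exact ⟨h₂.symm, (inArc_rotate h₂.symm h₃.symm h₁).1 ((inArc_rotate h₃ h₁.symm h₂.symm).1 h.2)⟩

/-- Three distinct points of a circle that are not in one cyclic order are in the other one. -/
theorem not_inOpenArc_iff {a b c : ZMod n} (hab : a ≠ b) (hac : a ≠ c) (hbc : b ≠ c) :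
    ¬ InOpenArc a c b ↔ InOpenArc b c a := by
  have := (ZMod.val_injective n).ne hab
  have := (ZMod.val_injective n).ne hac
  have := (ZMod.val_injective n).ne hbc
  simp only [InOpenArc, inArc_iff, ne_eq, hab, hab.symm, not_false_eq_true, true_and]
  omega

theorem inArc_succ_of_ne {i j : ZMod n} (hij : i ≠ j) (hj : j ≠ j + 1) (hij' : i ≠ j + 1) :
    InArc i (j + 1) j := by
  rw [← not_inArc_comm hij hij' hj, inArc_rotate hij hij' hj]
  exact fun h => hij (eq_of_inArc_succ h)

end Thin

/-! ### Cocycles on empty rectangles -/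

/-- A function on empty rectangles (given by the initial generator and the vertical edges) whose
products agree along the two decompositions of a domain and are trivial on annuli. The ratio of two
sign assignments is of this kind. -/
structure IsCocycle {n : ℕ} (φ : Gen n → ZMod n → ZMod n → ℤˣ) : Prop where
  square : ∀ (x y y' : Gen n) (a b c d a' b' c' d' : ZMod n), x.HasRect a b →
    y = x * Equiv.swap a b → y.HasRect c d → x.HasRect a' b' → y' = x * Equiv.swap a' b' →
    y'.HasRect c' d' → y * Equiv.swap c d = y' * Equiv.swap c' d' → y ≠ y' →
    (∀ i j, compChain x y a b c d i j = compChain x y' a' b' c' d' i j) →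
    φ x a b * φ y c d = φ x a' b' * φ y' c' d'
  vertical : ∀ (x : Gen n) (a b : ZMod n), x.HasRect a b → (x * Equiv.swap a b).HasRect a b →
    φ (x * Equiv.swap a b) a b = φ x a b
  horizontal : ∀ (x : Gen n) (a b : ZMod n), x.HasRect a b → (x * Equiv.swap a b).HasRect b a →
    φ (x * Equiv.swap a b) b a = φ x a b

theorem Gen.mul_swap_ne_mul_swap {n : ℕ} (x : Gen n) {a b c d : ZMod n} (hac : a ≠ c) (had : a ≠ d)
    (hab : a ≠ b) : x * Equiv.swap a b ≠ x * Equiv.swap c d := fun h => by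
  have := Equiv.congr_fun (mul_left_cancel h) a
  rw [Equiv.swap_apply_left, Equiv.swap_apply_of_ne_of_ne hac had] at this
  exact hab this.symm

theorem EmptyRects.ne_of_source_ne {n : ℕ} {x y x' y' : Gen n} {r : EmptyRect x y}
    {r' : EmptyRect x' y'} (h : x ≠ x') : r.mk ≠ r'.mk :=
  fun h' => h (congrArg Sigma.fst h')

theorem EmptyRects.ne_of_target_ne {n : ℕ} {x y x' y' : Gen n} {r : EmptyRect x y}
    {r' : EmptyRect x' y'} (h : y ≠ y') : r.mk ≠ r'.mk :=
  fun h' => h (congrArg (fun r : EmptyRects n => r.2.1) h')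

open Classical in
/-- The ratio of two functions on empty rectangles, extended by `1` to all rectangles. -/
noncomputable def signRatio {n : ℕ} (S₁ S₂ : EmptyRects n → ℤˣ) (x : Gen n) (a b : ZMod n) : ℤˣ :=
  if h : x.HasRect a b then S₁ h.rect.mk * S₂ h.rect.mk else 1

theorem signRatio_eq {n : ℕ} (S₁ S₂ : EmptyRects n → ℤˣ) {x : Gen n} {a b : ZMod n}
    (h : x.HasRect a b) : signRatio S₁ S₂ x a b = S₁ h.rect.mk * S₂ h.rect.mk :=
  dif_pos h

theorem Gen.mul_swap_ne {n : ℕ} (x : Gen n) {a b : ZMod n} (hab : a ≠ b) :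
    x * Equiv.swap a b ≠ x := fun h => by
  have := x.injective (Equiv.congr_fun h a)
  rw [Equiv.swap_apply_left] at this
  exact hab this.symm

theorem units_ratio {a b a' b' : ℤˣ} (e : ℤˣ) (h : a * b = e) (h' : a' * b' = e) :
    a * a' * (b * b') = 1 := by
  revert a b a' b' e; decide

theorem units_ratio_square {a b c d a' b' c' d' : ℤˣ} (h : a * b = -(c * d))
    (h' : a' * b' = -(c' * d')) : a * a' * (b * b') = c * c' * (d * d') := by
  rw [mul_mul_mul_comm, h, h', neg_mul_neg, mul_mul_mul_comm]

theorem units_eq_of_mul_eq_one {a b : ℤˣ} (h : a * b = 1) : b = a := by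
  revert a b; decide

theorem IsSignAssignment.isCocycle_ratio {n : ℕ} [NeZero n] {S₁ S₂ : EmptyRects n → ℤˣ}
    (h₁ : IsSignAssignment S₁) (h₂ : IsSignAssignment S₂) : IsCocycle (signRatio S₁ S₂) := by
  refine ⟨?_, ?_, ?_⟩
  · rintro x y y' a b c d a' b' c' d' r₁ rfl r₂ r₁' rfl r₂' hz hne hchain
    rw [signRatio_eq _ _ r₁, signRatio_eq _ _ r₂, signRatio_eq _ _ r₁', signRatio_eq _ _ r₂']
    -- The second primed rectangle, with its final generator rewritten to the common one.
    have key : ∀ (z : Gen n) (hz : z = x * Equiv.swap a' b' * Equiv.swap c' d'),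
        ∃ q : EmptyRect (x * Equiv.swap a' b') z, q.mk = r₂'.rect.mk := by
      rintro z rfl
      exact ⟨_, rfl⟩
    obtain ⟨q, hq⟩ := key _ hz
    rw [← hq]
    have hnd : [r₁.rect.mk, r₂.rect.mk, r₁'.rect.mk, q.mk].Nodup := by
      have e₁ := x.mul_swap_ne r₁.ne
      have e₂ := x.mul_swap_ne r₁'.ne
      simp only [List.nodup_cons, List.mem_cons, List.not_mem_nil, or_false, not_or,
        not_false_eq_true, List.nodup_nil, and_true]
      exact ⟨⟨EmptyRects.ne_of_source_ne e₁.symm, EmptyRects.ne_of_target_ne hne,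
        EmptyRects.ne_of_source_ne e₂.symm⟩, ⟨EmptyRects.ne_of_source_ne e₁,
        EmptyRects.ne_of_source_ne hne⟩, EmptyRects.ne_of_source_ne e₂.symm⟩
    have hdom : r₁.rect.domain.comp r₂.rect.domain = r₁'.rect.domain.comp q.domain := by
      refine Subtype.ext (funext fun i => funext fun j => ?_)
      have hq' : q.1 = r₂'.rect.1 := by
        have := congrArg (fun r : EmptyRects n => r.2.2.1) hq
        exact this
      rw [EmptyRect.comp_domain_apply, EmptyRect.comp_domain_apply, hq']
      exact hchain i j
    exact units_ratio_square (h₁.square _ _ _ _ _ _ _ _ hnd hdom)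
      (h₂.square _ _ _ _ _ _ _ _ hnd hdom)
  · intro x a b r₁ r₂
    rw [signRatio_eq _ _ r₁, signRatio_eq _ _ r₂]
    have h : TwoChain.IsVerticalAnnulus (r₁.rect.domain.comp r₂.rect.domain).1 :=
      ⟨a, b, r₁.ne, fun i j =>
        (EmptyRect.comp_domain_apply _ _ i j).trans (compChain_vertical x r₁.ne i j)⟩
    exact units_eq_of_mul_eq_one (units_ratio (-1) (h₁.vertical _ _ _ _ _ h)
      (h₂.vertical _ _ _ _ _ h))
  · intro x a b r₁ r₂
    rw [signRatio_eq _ _ r₁, signRatio_eq _ _ r₂]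
    have h : TwoChain.IsHorizontalAnnulus (r₁.rect.domain.comp r₂.rect.domain).1 :=
      ⟨x a, x b, x.injective.ne r₁.ne, fun i j =>
        (EmptyRect.comp_domain_apply _ _ i j).trans (compChain_horizontal x r₁.ne i j)⟩
    exact units_eq_of_mul_eq_one (units_ratio 1 (h₁.horizontal _ _ _ _ _ h)
      (h₂.horizontal _ _ _ _ _ h))

/-- Multiplying by a coboundary. -/
theorem IsCocycle.mul_coboundary {n : ℕ} {φ : Gen n → ZMod n → ZMod n → ℤˣ} (hφ : IsCocycle φ)
    (f : Gen n → ℤˣ) :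
    IsCocycle fun x a b => φ x a b * (f x * f (x * Equiv.swap a b)) := by
  have key : ∀ p q p' q' fx fy fy' fz : ℤˣ, p * q = p' * q' →
      p * (fx * fy) * (q * (fy * fz)) = p' * (fx * fy') * (q' * (fy' * fz)) := by decide
  refine ⟨?_, fun x a b h₁ h₂ => ?_, fun x a b h₁ h₂ => ?_⟩
  · rintro x y y' a b c d a' b' c' d' h₁ rfl h₂ h₁' rfl h₂' hz hne hchain
    rw [← hz]
    exact key _ _ _ _ _ _ _ _ (hφ.square _ _ _ _ _ _ _ _ _ _ _ h₁ rfl h₂ h₁' rfl h₂' hz hne hchain)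
  · rw [hφ.vertical x a b h₁ h₂, x.mul_swap_mul_swap, mul_comm (f x)]
  · rw [hφ.horizontal x a b h₁ h₂, Equiv.swap_comm b a, x.mul_swap_mul_swap, mul_comm (f x)]

theorem IsCocycle.disjoint {n : ℕ} {φ : Gen n → ZMod n → ZMod n → ℤˣ}
    (hφ : IsCocycle φ) {x : Gen n} {a b c d : ZMod n} (hac : a ≠ c)
    (had : a ≠ d) (hbc : b ≠ c) (hbd : b ≠ d) (h₁ : x.HasRect a b)
    (h₂ : (x * Equiv.swap a b).HasRect c d) (h₁' : x.HasRect c d)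
    (h₂' : (x * Equiv.swap c d).HasRect a b) :
    φ x a b * φ (x * Equiv.swap a b) c d = φ x c d * φ (x * Equiv.swap c d) a b := by
  refine hφ.square _ _ _ _ _ _ _ _ _ _ _ h₁ rfl h₂ h₁' rfl h₂' ?_
    (x.mul_swap_ne_mul_swap hac had h₁.ne) fun i j => ?_
  · rw [mul_assoc, mul_assoc, (Equiv.Perm.disjoint_swap_swap (by simp [*, h₁.ne, h₁'.ne])).commute]
  · simp only [compChain, Equiv.Perm.mul_apply, Equiv.swap_apply_of_ne_of_ne hac had,
      Equiv.swap_apply_of_ne_of_ne hbc hbd, Equiv.swap_apply_of_ne_of_ne hac.symm hbc.symm,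
      Equiv.swap_apply_of_ne_of_ne had.symm hbd.symm]
    ring

/-- The value of a cocycle on a rectangle of width one does not depend on the direction. -/
theorem IsCocycle.thin_symm {n : ℕ} {φ : Gen n → ZMod n → ZMod n → ℤˣ}
    (hφ : IsCocycle φ) (x : Gen n) {i : ZMod n} (hi : i ≠ i + 1) :
    φ (x * Equiv.swap i (i + 1)) i (i + 1) = φ x i (i + 1) :=
  hφ.vertical x i (i + 1) (x.hasRect_succ hi) (Gen.hasRect_succ _ hi)

theorem IsCocycle.thin_comm {n : ℕ} {φ : Gen n → ZMod n → ZMod n → ℤˣ}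
    (hφ : IsCocycle φ) (x : Gen n) {i j : ZMod n} (hi : i ≠ i + 1)
    (hj : j ≠ j + 1) (hij : i ≠ j) (hij' : i ≠ j + 1) (hji : j ≠ i + 1) :
    φ x i (i + 1) * φ (x * Equiv.swap i (i + 1)) j (j + 1) =
      φ x j (j + 1) * φ (x * Equiv.swap j (j + 1)) i (i + 1) :=
  hφ.disjoint hij hij' hji.symm (fun h => hij (add_right_cancel h)) (x.hasRect_succ hi)
    (Gen.hasRect_succ _ hj) (x.hasRect_succ hj) (Gen.hasRect_succ _ hi)

section Cocycle

variable {n : ℕ} [NeZero n] {φ : Gen n → ZMod n → ZMod n → ℤˣ}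

theorem swap_mul_swap_rotate {α : Type*} [DecidableEq α] {i j k : α} (hij : i ≠ j) (hik : i ≠ k)
    (hjk : j ≠ k) :
    Equiv.swap i j * Equiv.swap j k = Equiv.swap j k * Equiv.swap i k := by
  ext t
  simp only [Equiv.Perm.mul_apply, Equiv.swap_apply_def]
  grind

/-- The domain `[i, j] × [A, B] ∪ [j, k] × [A, C]` is also `[j, k] × [B, C] ∪ [i, k] × [A, B]`. -/
theorem IsCocycle.ell_left (hφ : IsCocycle φ) {x : Gen n} {i j k : ZMod n} (hc : InOpenArc i k j)
    (hr : InOpenArc (x i) (x k) (x j)) (h₁ : x.HasRect i j)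
    (h₂ : (x * Equiv.swap i j).HasRect j k) (h₁' : x.HasRect j k)
    (h₂' : (x * Equiv.swap j k).HasRect i k) :
    φ x i j * φ (x * Equiv.swap i j) j k = φ x j k * φ (x * Equiv.swap j k) i k := by
  obtain ⟨hji, hjk, hik⟩ := hc.ne
  refine hφ.square _ _ _ _ _ _ _ _ _ _ _ h₁ rfl h₂ h₁' rfl h₂' ?_
    (x.mul_swap_ne_mul_swap hji.symm hik hji.symm) fun a b => ?_
  · rw [mul_assoc, mul_assoc, swap_mul_swap_rotate hji.symm hik hjk]
  · simp only [compChain, Equiv.Perm.mul_apply, Equiv.swap_apply_right,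
      Equiv.swap_apply_of_ne_of_ne hik.symm hjk.symm, Equiv.swap_apply_of_ne_of_ne hji.symm hik,
      arcInd_add hc.2 a, arcInd_add hr.2 b]
    ring

/-- The domain `[j, k] × [B, C] ∪ [i, j] × [A, C]` is also `[i, j] × [A, B] ∪ [i, k] × [B, C]`. -/
theorem IsCocycle.ell_right (hφ : IsCocycle φ) {x : Gen n} {i j k : ZMod n} (hc : InOpenArc i k j)
    (hr : InOpenArc (x i) (x k) (x j)) (h₁ : x.HasRect j k)
    (h₂ : (x * Equiv.swap j k).HasRect i j) (h₁' : x.HasRect i j)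
    (h₂' : (x * Equiv.swap i j).HasRect i k) :
    φ x j k * φ (x * Equiv.swap j k) i j = φ x i j * φ (x * Equiv.swap i j) i k := by
  obtain ⟨hji, hjk, hik⟩ := hc.ne
  refine hφ.square _ _ _ _ _ _ _ _ _ _ _ h₁ rfl h₂ h₁' rfl h₂' ?_
    (x.mul_swap_ne_mul_swap hji.symm hik hji.symm).symm fun a b => ?_
  · have := swap_mul_swap_rotate hjk.symm hik.symm hji
    rw [Equiv.swap_comm k j, Equiv.swap_comm j i, Equiv.swap_comm k i] at this
    rw [mul_assoc, mul_assoc, this]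
  · simp only [compChain, Equiv.Perm.mul_apply, Equiv.swap_apply_left,
      Equiv.swap_apply_of_ne_of_ne hik.symm hjk.symm, Equiv.swap_apply_of_ne_of_ne hji.symm hik,
      arcInd_add hc.2 a, arcInd_add hr.2 b]
    ring

theorem swap_braid {α : Type*} [DecidableEq α] {i j k : α} (hij : i ≠ j) (hik : i ≠ k)
    (hjk : j ≠ k) : Equiv.swap i j * Equiv.swap j k * Equiv.swap i j =
      Equiv.swap j k * Equiv.swap i j * Equiv.swap j k := by
  ext t
  simp only [Equiv.Perm.mul_apply, Equiv.swap_apply_def]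
  grind

/-- The braid relation for rectangles of width one. The two L-shaped domains that contain the
same rectangle of width two give it. -/
theorem IsCocycle.hexagon (hφ : IsCocycle φ) (x : Gen n) {i j k : ZMod n} (hj : j = i + 1)
    (hk : k = j + 1) (hij : i ≠ j) (hik : i ≠ k) (hjk : j ≠ k) :
    φ x i j * φ (x * Equiv.swap i j) j k * φ (x * Equiv.swap i j * Equiv.swap j k) i j =
      φ x j k * φ (x * Equiv.swap j k) i j * φ (x * Equiv.swap j k * Equiv.swap i j) j k := by
  have hi' (z : Gen n) : z.HasRect i j := by subst hj; exact z.hasRect_succ hij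
  have hj' (z : Gen n) : z.HasRect j k := by subst hk; exact z.hasRect_succ hjk
  have hsi (z : Gen n) : φ (z * Equiv.swap i j) i j = φ z i j := hφ.vertical z i j (hi' z) (hi' _)
  have hsj (z : Gen n) : φ (z * Equiv.swap j k) j k = φ z j k := hφ.vertical z j k (hj' z) (hj' _)
  have hcol : InOpenArc i k j := ⟨hij.symm, by subst hk; exact inArc_succ_of_ne hij hjk hik⟩
  have hmid {t : ZMod n} (ht : InOpenArc i k t) : t = j := by
    obtain h | h := inArc_split j ht.2
    · subst hj; exact absurd (eq_of_inArc_succ h) ht.1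
    · subst hk; exact eq_of_inArc_succ h
  have braid (z : Gen n) : z * Equiv.swap i j * Equiv.swap j k * Equiv.swap i j =
      z * Equiv.swap j k * Equiv.swap i j * Equiv.swap j k := by
    simp only [mul_assoc]
    rw [← mul_assoc (Equiv.swap i j), ← mul_assoc (Equiv.swap j k), swap_braid hij hik hjk]
  have key₁ : ∀ a b c w d e f : ℤˣ, a * b = c * w → d * e = f * w → c * f * d = a * b * e := by
    decide
  have main (z : Gen n) (hz : InOpenArc (z i) (z k) (z j)) :
      φ z i j * φ (z * Equiv.swap i j) j k * φ (z * Equiv.swap i j * Equiv.swap j k) i j =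
        φ z j k * φ (z * Equiv.swap j k) i j * φ (z * Equiv.swap j k * Equiv.swap i j) j k := by
    obtain ⟨hz₁, hz₂, hz₃⟩ := hz.ne
    have hsk : Equiv.swap i j k = k := Equiv.swap_apply_of_ne_of_ne hik.symm hjk.symm
    have hsi' : Equiv.swap j k i = i := Equiv.swap_apply_of_ne_of_ne hij hik
    have hwide : (z * Equiv.swap i j).HasRect i k := by
      refine ⟨hik, fun t ⟨ht, ht'⟩ => ?_⟩
      rw [hmid ht, Equiv.Perm.mul_apply, Equiv.Perm.mul_apply, Equiv.Perm.mul_apply, hsk,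
        Equiv.swap_apply_left, Equiv.swap_apply_right] at ht'
      exact (not_inOpenArc_iff hz₁.symm hz₃ hz₂).2 ht' hz
    have e₁ := hφ.ell_right hcol hz (hj' z) (hi' _) (hi' z) hwide
    have e₂ := hφ.ell_left (x := z * Equiv.swap i j * Equiv.swap j k) hcol (by
      simp only [InOpenArc, Equiv.Perm.mul_apply, Equiv.swap_apply_left, Equiv.swap_apply_right,
        hsk, hsi']
      exact hz.rotate) (hi' _) (hj' _) (hj' _) (by rwa [Gen.mul_swap_mul_swap])
    rw [Gen.mul_swap_mul_swap, braid, hsj, hsj] at e₂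
    exact key₁ _ _ _ _ _ _ _ e₁ e₂
  have key₂ : ∀ a b c d e f : ℤˣ, c * a * b = f * d * e → c * f * d = a * b * e := by decide
  by_cases hx : InOpenArc (x i) (x k) (x j)
  · exact main x hx
  · have e := main (x * Equiv.swap i j) (by
      simp only [InOpenArc, Equiv.Perm.mul_apply, Equiv.swap_apply_left, Equiv.swap_apply_right,
        Equiv.swap_apply_of_ne_of_ne hik.symm hjk.symm]
      exact (not_inOpenArc_iff (x.injective.ne hij) (x.injective.ne hik) (x.injective.ne hjk)).1 hx)
    rw [hsi, Gen.mul_swap_mul_swap, braid, hsj] at e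
    exact key₂ _ _ _ _ _ _ e

end Cocycle

/-! ### Uniqueness -/

/-- `i` is a descent of `x`, viewed as a sequence on the columns `0, …, n - 1`. -/
def Gen.IsDescent {n : ℕ} (x : Gen n) (i : ZMod n) : Prop :=
  i ≠ -1 ∧ (x (i + 1)).val < (x i).val

theorem Gen.IsDescent.ne {n : ℕ} {x : Gen n} {i : ZMod n} (h : x.IsDescent i) :
    i ≠ i + 1 := fun h' => by
  have := h.2
  rw [← h'] at this
  exact lt_irrefl _ this

section Uniqueness

variable {n : ℕ} [NeZero n] {φ : Gen n → ZMod n → ZMod n → ℤˣ}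

theorem val_add_one_of_ne {i : ZMod n} (hi : i ≠ -1) : (i + 1).val = i.val + 1 := by
  have h : i.val + 1 < n ∨ i.val + 1 = n := by
    have := ZMod.val_lt i
    omega
  obtain h | h := h
  · rw [ZMod.val_add_of_lt, ZMod.val_one_eq_one_mod, Nat.mod_eq_of_lt (by omega)]
    rw [ZMod.val_one_eq_one_mod, Nat.mod_eq_of_lt (by omega)]
    exact h
  · refine absurd ?_ hi
    have h' : ((i.val + 1 : ℕ) : ZMod n) = 0 := by rw [h, ZMod.natCast_self]
    rw [Nat.cast_add, ZMod.natCast_rightInverse i, Nat.cast_one] at h'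
    exact eq_neg_of_add_eq_zero_left h'

/-- A quantity that measures how far `x` is from being sorted. -/
def Gen.disorder (x : Gen n) : ℕ := ∑ i : ZMod n, (n - i.val) * (x i).val

theorem Gen.IsDescent.disorder_lt {x : Gen n} {i : ZMod n} (h : x.IsDescent i) :
    (x * Equiv.swap i (i + 1)).disorder < x.disorder := by
  have hne := h.ne
  have hmem : i + 1 ∈ Finset.univ.erase i := by simpa using hne.symm
  unfold Gen.disorder
  rw [← Finset.add_sum_erase _ _ (Finset.mem_univ i), ← Finset.add_sum_erase _ _ hmem,
    ← Finset.add_sum_erase _ _ (Finset.mem_univ i), ← Finset.add_sum_erase _ _ hmem,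
    ← add_assoc, ← add_assoc]
  refine add_lt_add_of_lt_of_le ?_ (Finset.sum_le_sum fun t ht => le_of_eq ?_)
  · have h₁ := h.2
    have h₂ := val_add_one_of_ne h.1
    have h₃ := ZMod.val_lt (i + 1)
    obtain ⟨m, hm⟩ : ∃ m, n - (i + 1).val = m := ⟨_, rfl⟩
    have hm' : n - i.val = m + 1 := by omega
    simp only [Equiv.Perm.mul_apply, Equiv.swap_apply_left, Equiv.swap_apply_right, hm, hm']
    nlinarith
  · simp only [Finset.mem_erase] at ht
    rw [Equiv.Perm.mul_apply, Equiv.swap_apply_of_ne_of_ne ht.2.1 ht.1]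

open Classical in
/-- The product of the values of `φ` along a path that sorts `x` by removing descents. -/
noncomputable def sortingPotential (φ : Gen n → ZMod n → ZMod n → ℤˣ) (x : Gen n) : ℤˣ :=
  if h : ∃ i, x.IsDescent i then
    sortingPotential φ (x * Equiv.swap h.choose (h.choose + 1)) * φ x h.choose (h.choose + 1)
  else 1
termination_by x.disorder
decreasing_by exact h.choose_spec.disorder_lt

/-- The sorting potential does not depend on the sorting path: two different descents are joined by
a commutation relation or by a braid relation. -/
theorem IsCocycle.sortingPotential_eq (hφ : IsCocycle φ) {x : Gen n} {i : ZMod n}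
    (hi : x.IsDescent i) : sortingPotential φ x =
      sortingPotential φ (x * Equiv.swap i (i + 1)) * φ x i (i + 1) := by
  induction hd : x.disorder using Nat.strong_induction_on generalizing x i with
  | _ d ih =>
  subst hd
  have step {y : Gen n} {j k : ZMod n} (hy : y.disorder < x.disorder) (hk : k = j + 1)
      (hj : j ≠ -1) (hlt : (y k).val < (y j).val) :
      (y * Equiv.swap j k).disorder < x.disorder ∧
        sortingPotential φ y = sortingPotential φ (y * Equiv.swap j k) * φ y j k := by
    subst hk
    have hd : y.IsDescent j := ⟨hj, hlt⟩
    exact ⟨hd.disorder_lt.trans hy, ih _ hy hd rfl⟩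
  have adjacent (i j k : ZMod n) (hj : j = i + 1) (hk : k = j + 1) (hi : x.IsDescent i)
      (hj' : x.IsDescent j) : sortingPotential φ (x * Equiv.swap i j) * φ x i j =
        sortingPotential φ (x * Equiv.swap j k) * φ x j k := by
    have hs : (x * Equiv.swap i j).disorder < x.disorder := hj ▸ hi.disorder_lt
    have ht : (x * Equiv.swap j k).disorder < x.disorder := hk ▸ hj'.disorder_lt
    obtain ⟨hi, hji⟩ := hi
    obtain ⟨hj₁, hkj⟩ := hj'
    rw [← hj] at hji
    rw [← hk] at hkj
    have hij : i ≠ j := fun h => hji.ne (by rw [h])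
    have hjk : j ≠ k := fun h => hkj.ne (by rw [h])
    have hik : i ≠ k := fun h => (hkj.trans hji).ne (by rw [h])
    have hsk : Equiv.swap i j k = k := Equiv.swap_apply_of_ne_of_ne hik.symm hjk.symm
    have hsi : Equiv.swap j k i = i := Equiv.swap_apply_of_ne_of_ne hij hik
    obtain ⟨l₁, s₁⟩ := step hs hk hj₁ (by simpa [hsk] using hkj.trans hji)
    obtain ⟨-, s₂⟩ := step l₁ hj hi (by simpa [hsk, hsi] using hkj)
    obtain ⟨l₃, s₃⟩ := step ht hj hi (by simpa [hsi] using hkj.trans hji)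
    obtain ⟨-, s₄⟩ := step l₃ hk hj₁ (by simpa [hsk, hsi] using hji)
    have braid : x * Equiv.swap i j * Equiv.swap j k * Equiv.swap i j =
        x * Equiv.swap j k * Equiv.swap i j * Equiv.swap j k := by
      simp only [mul_assoc]
      rw [← mul_assoc (Equiv.swap i j), ← mul_assoc (Equiv.swap j k), swap_braid hij hik hjk]
    rw [s₁, s₂, s₃, s₄, braid]
    have key : ∀ p a b c a' b' c' : ℤˣ, a * b * c = a' * b' * c' →
        p * c * b * a = p * c' * b' * a' := by decide
    exact key _ _ _ _ _ _ _ (hφ.hexagon x hj hk hij hik hjk)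
  have hex : ∃ i, x.IsDescent i := ⟨i, hi⟩
  have hj := hex.choose_spec
  rw [sortingPotential, dif_pos hex]
  generalize hex.choose = j at hj
  by_cases hij : i = j
  · rw [hij]
  by_cases hji' : j = i + 1
  · subst hji'
    exact (adjacent i _ _ rfl rfl hi hj).symm
  by_cases hij' : i = j + 1
  · subst hij'
    exact adjacent j _ _ rfl rfl hj hi
  have hij'' : i + 1 ≠ j + 1 := fun h => hij (add_right_cancel h)
  have e := hφ.thin_comm x hi.ne hj.ne hij hij' hji'
  have d₁ : (x * Equiv.swap i (i + 1)).IsDescent j := by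
    refine ⟨hj.1, ?_⟩
    rw [Equiv.Perm.mul_apply, Equiv.Perm.mul_apply,
      Equiv.swap_apply_of_ne_of_ne (Ne.symm hij) hji',
      Equiv.swap_apply_of_ne_of_ne (Ne.symm hij') hij''.symm]
    exact hj.2
  have d₂ : (x * Equiv.swap j (j + 1)).IsDescent i := by
    refine ⟨hi.1, ?_⟩
    rw [Equiv.Perm.mul_apply, Equiv.Perm.mul_apply,
      Equiv.swap_apply_of_ne_of_ne hij hij',
      Equiv.swap_apply_of_ne_of_ne (Ne.symm hji') hij'']
    exact hi.2
  rw [(step hi.disorder_lt rfl d₁.1 d₁.2).2, (step hj.disorder_lt rfl d₂.1 d₂.2).2]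
  have hcomm : x * Equiv.swap i (i + 1) * Equiv.swap j (j + 1) =
      x * Equiv.swap j (j + 1) * Equiv.swap i (i + 1) := by
    rw [mul_assoc, mul_assoc, (Equiv.Perm.disjoint_swap_swap
      (by simp [hij, hij', hi.ne, hj.ne, Ne.symm hji'])).commute]
  rw [hcomm]
  have key : ∀ p a b a' b' : ℤˣ, a * b = a' * b' → p * b' * a' = p * b * a := by decide
  exact key _ _ _ _ _ e

/-- After division by a coboundary, a cocycle is trivial on the rectangles of width one that do not
cross the column between the circles `n - 1` and `0`. -/
theorem IsCocycle.exists_trivial_thin (hφ : IsCocycle φ) : ∃ f : Gen n → ℤˣ,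
    ∀ x i, i ≠ -1 → φ x i (i + 1) * (f x * f (x * Equiv.swap i (i + 1))) = 1 := by
  refine ⟨sortingPotential φ, fun x i hi => ?_⟩
  have key : ∀ p q a : ℤˣ, p = q * a → a * (p * q) = 1 := by decide
  by_cases hi' : i = i + 1
  · have : (1 : ZMod n) = 0 := by simpa using hi'.symm
    have : Subsingleton (ZMod n) := subsingleton_of_zero_eq_one this.symm
    exact absurd (Subsingleton.elim _ _) hi
  obtain h | h := lt_or_gt_of_ne ((ZMod.val_injective n).ne (x.injective.ne hi'))
  · have hd : (x * Equiv.swap i (i + 1)).IsDescent i := ⟨hi, by simpa using h⟩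
    have e := hφ.sortingPotential_eq hd
    rw [Gen.mul_swap_mul_swap, hφ.thin_symm x hi'] at e
    rw [mul_comm (sortingPotential φ x)]
    exact key _ _ _ e
  · exact key _ _ _ (hφ.sortingPotential_eq ⟨hi, h⟩)

/-- The value of a cocycle on a rectangle is determined by its values on rectangles of width one
in the same columns. -/
theorem IsCocycle.eq_one_of_thin (hφ : IsCocycle φ) {x : Gen n} {i k : ZMod n}
    (hthin : ∀ t, InArc i k t → ∀ y, φ y t (t + 1) = 1) (hx : x.HasRect i k) : φ x i k = 1 := by
  induction hd : (k - i).val using Nat.strong_induction_on generalizing x k with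
  | _ d ih =>
  subst hd
  obtain ⟨j, rfl⟩ : ∃ j, k = j + 1 := ⟨k - 1, by ring⟩
  by_cases hij : i = j
  · subst hij
    exact hthin i (inArc_left hx.ne) x
  have hj : j ≠ j + 1 := fun h => by
    have : (1 : ZMod n) = 0 := by simpa using h.symm
    have : Subsingleton (ZMod n) := subsingleton_of_zero_eq_one this.symm
    exact hij (Subsingleton.elim _ _)
  have hc : InOpenArc i (j + 1) j := ⟨Ne.symm hij, inArc_succ_of_ne hij hj hx.ne⟩
  have hsi : Equiv.swap j (j + 1) i = i := Equiv.swap_apply_of_ne_of_ne hij hx.ne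
  let y := x * Equiv.swap j (j + 1)
  have hyi : y i = x i := by rw [Equiv.Perm.mul_apply, hsi]
  have hyj : y j = x (j + 1) := by rw [Equiv.Perm.mul_apply, Equiv.swap_apply_left]
  have hyk : y (j + 1) = x j := by rw [Equiv.Perm.mul_apply, Equiv.swap_apply_right]
  have hyx : y * Equiv.swap j (j + 1) = x := x.mul_swap_mul_swap _ _
  have hy : y.HasRect i j := by
    refine ⟨hij, fun t ⟨ht, ht'⟩ => hx.empty t ?_⟩
    have htk : InArc i (j + 1) t := lt_trans ht.2 hc.2
    have htj := ht.ne.2.1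
    have htj' : t ≠ j + 1 := fun h => not_inArc_right (h ▸ htk)
    rw [hyi, hyj, Equiv.Perm.mul_apply, Equiv.swap_apply_of_ne_of_ne htj htj'] at ht'
    exact ⟨⟨ht.1, htk⟩, ht'⟩
  have hr : InOpenArc (y i) (y (j + 1)) (y j) := by
    rw [hyi, hyj, hyk]
    exact (not_inOpenArc_iff (a := x i) (x.injective.ne hij) (x.injective.ne hx.ne)
      (x.injective.ne hj)).1 (fun h => hx.empty j ⟨hc, h⟩) |>.rotate
  have e := hφ.ell_left hc hr hy (Gen.hasRect_succ _ hj) (y.hasRect_succ hj) (by rwa [hyx])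
  rw [hthin j hc.2, hthin j hc.2, hyx, mul_one, one_mul] at e
  rw [← e]
  exact ih _ hc.2 (fun t ht => hthin t (lt_trans ht hc.2)) hy rfl

/-- If a cocycle is trivial on all rectangles of width one away from the last column, then also on
those in the last column. -/
theorem IsCocycle.last_thin (hφ : IsCocycle φ) (hthin : ∀ x i, i ≠ -1 → φ x i (i + 1) = 1)
    (hn : (1 : ZMod n) ≠ 0) (x : Gen n) : φ x (-1) 0 = 1 := by
  have h01 : (-1 : ZMod n) ≠ 0 := neg_ne_zero.2 hn
  have hthin' (x : Gen n) (i j : ZMod n) (hi : i ≠ -1) (hj : j = i + 1) : φ x i j = 1 := by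
    rw [hj]; exact hthin x i hi
  have hlast (x : Gen n) : x.HasRect (-1) 0 := by
    have := x.hasRect_succ (i := -1) (by rwa [neg_add_cancel])
    rwa [neg_add_cancel] at this
  -- Induction on the height of the rectangle.
  induction hd : (x 0 - x (-1)).val using Nat.strong_induction_on generalizing x with
  | _ d ih =>
  subst hd
  by_cases h₁ : x 0 = x (-1) + 1
  · -- In height one the complement in the horizontal annulus does not meet the last column.
    have hr : (x * Equiv.swap (-1) 0).HasRect 0 (-1) :=
      Gen.hasRect_of_row_succ _ h01.symm (by simpa using h₁)
    rw [← hφ.horizontal x (-1) 0 (hlast x) hr]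
    exact hφ.eq_one_of_thin (fun t ht y => hthin y t (fun h => not_inArc_right (h ▸ ht))) hr
  -- `m` is the column of the point one row below the upper edge.
  obtain ⟨m, hm⟩ := x.surjective (x 0 - 1)
  have hm0 : m ≠ 0 := fun h => by
    rw [h, eq_comm, sub_eq_self] at hm
    exact hn hm
  have hm1 : m ≠ -1 := fun h => h₁ (by rw [← h, hm]; ring)
  have hone : (1 : ZMod n).val = 1 := by
    have := val_add_one_of_ne (i := (0 : ZMod n)) h01.symm
    simpa using this
  -- Move this point to column `1`.
  induction hv : m.val generalizing x m with
  | zero => exact absurd ((ZMod.val_eq_zero m).1 hv) hm0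
  | succ v ihv =>
  have hd0 : (x 0 - x (-1)).val ≠ 0 := by
    rw [Ne, ZMod.val_eq_zero, sub_eq_zero]
    exact x.injective.ne h01.symm
  by_cases hv0 : v = 0
  · have hm' : m = 1 := ZMod.val_injective n (by rw [hv, hv0, hone])
    subst hm'
    have e := hφ.hexagon x (i := -1) (j := 0) (k := 1) (neg_add_cancel 1).symm (zero_add 1).symm
      h01 hm1.symm hn.symm
    have h1 (y : Gen n) : φ y 0 1 = 1 := hthin' y 0 1 h01.symm (zero_add 1).symm
    have hs1 : Equiv.swap (-1 : ZMod n) 0 1 = 1 := Equiv.swap_apply_of_ne_of_ne hm1 hm0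
    have ht1 : Equiv.swap (0 : ZMod n) 1 (-1) = -1 :=
      Equiv.swap_apply_of_ne_of_ne h01 hm1.symm
    have hlow : φ (x * Equiv.swap 0 1) (-1) 0 = 1 := by
      refine ih _ ?_ _ rfl
      simp only [Equiv.Perm.mul_apply, Equiv.swap_apply_left, ht1, hm]
      have : x 0 - 1 - x (-1) = x 0 - x (-1) - 1 := by ring
      rw [this, ZMod.val_sub (by rw [hone]; omega), hone]
      omega
    have hone' : φ (x * Equiv.swap (-1) 0 * Equiv.swap 0 1) (-1) 0 = 1 := by
      rw [← hφ.vertical _ _ _ (hlast _) (hlast _)]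
      refine ih _ ?_ _ rfl
      simp only [Equiv.Perm.mul_apply, Equiv.swap_apply_left, Equiv.swap_apply_right, ht1, hs1, hm,
        sub_sub_cancel, hone]
      have : (x 0 - x (-1)).val ≠ 1 := fun h => h₁ (by
        rw [← hone] at h
        rw [add_comm]
        exact sub_eq_iff_eq_add.1 (ZMod.val_injective n h))
      omega
    rwa [h1, h1, h1, hlow, hone', mul_one, mul_one, mul_one, mul_one] at e
  · obtain ⟨j, rfl⟩ : ∃ j, m = j + 1 := ⟨m - 1, by ring⟩
    have hj1 : j ≠ -1 := fun h => hm0 (by rw [h, neg_add_cancel])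
    have hjv : j.val = v := by
      have := val_add_one_of_ne hj1
      omega
    have hj0 : j ≠ 0 := fun h => hv0 (by rw [← hjv, h, ZMod.val_zero])
    have hjj : j ≠ j + 1 := by simpa using hn
    have e := hφ.disjoint hj1.symm hm1.symm hj0.symm hm0.symm (hlast x) (Gen.hasRect_succ _ hjj)
      (x.hasRect_succ hjj) (hlast _)
    rw [hthin _ _ hj1, hthin _ _ hj1, mul_one, one_mul] at e
    have h0' : (x * Equiv.swap j (j + 1)) 0 = x 0 := by
      rw [Equiv.Perm.mul_apply, Equiv.swap_apply_of_ne_of_ne hj0.symm hm0.symm]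
    have h1' : (x * Equiv.swap j (j + 1)) (-1) = x (-1) := by
      rw [Equiv.Perm.mul_apply, Equiv.swap_apply_of_ne_of_ne hj1.symm hm1.symm]
    rw [e]
    refine ihv _ ?_ ?_ j ?_ hj0 hj1 hjv
    · rw [h0', h1']
      exact ih
    · rw [h0', h1']
      exact h₁
    · rw [h0', Equiv.Perm.mul_apply, Equiv.swap_apply_left, hm]

/-- A cocycle on empty rectangles is a coboundary. -/
theorem IsCocycle.eq_coboundary (hφ : IsCocycle φ) : ∃ f : Gen n → ℤˣ,
    ∀ x a b, x.HasRect a b → φ x a b = f x * f (x * Equiv.swap a b) := by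
  obtain ⟨f, hf⟩ := hφ.exists_trivial_thin
  refine ⟨f, fun x a b hx => ?_⟩
  have key : ∀ p q : ℤˣ, p * q = 1 → p = q := by decide
  apply key
  have hψ := hφ.mul_coboundary f
  refine hψ.eq_one_of_thin (fun t _ y => ?_) hx
  by_cases ht : t = -1
  · have hn : (1 : ZMod n) ≠ 0 := fun h => by
      have : Subsingleton (ZMod n) := subsingleton_of_zero_eq_one h.symm
      exact hx.ne (Subsingleton.elim _ _)
    have := hψ.last_thin hf hn y
    rw [ht, neg_add_cancel]
    exact this
  · exact hf y t ht

end Uniqueness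

end ToroidalGrid

theorem theorem4p2 (n : ℕ) [NeZero n] :
    (∃ S : ToroidalGrid.EmptyRects n → ℤˣ, ToroidalGrid.IsSignAssignment S) ∧
    ∀ S₁ S₂ : ToroidalGrid.EmptyRects n → ℤˣ,
      ToroidalGrid.IsSignAssignment S₁ → ToroidalGrid.IsSignAssignment S₂ →
      ∃ f : ToroidalGrid.Gen n → ℤˣ,
        ∀ (x y : ToroidalGrid.Gen n) (r : ToroidalGrid.EmptyRect x y),
          S₁ r.mk = f x * f y * S₂ r.mk := by
  refine ⟨ToroidalGrid.exists_isSignAssignment n, fun S₁ S₂ h₁ h₂ => ?_⟩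
  obtain ⟨f, hf⟩ := (h₁.isCocycle_ratio h₂).eq_coboundary
  refine ⟨f, fun x y r => ?_⟩
  obtain ⟨a, b, h, hr, rfl⟩ := r.exists_eq_rect
  have key : ∀ s t p q : ℤˣ, s * t = p * q → s = p * q * t := by decide
  rw [hr]
  exact key _ _ _ _ ((ToroidalGrid.signRatio_eq S₁ S₂ h).symm.trans (hf x a b h))
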